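/- **Setting.** Let $\mathcal A=\{-1,1\}$, let $X\in\mathbb R^p$ be covariates, $U$ a latent confounder, $Z$ a treatment proxy, $W$ an outcome proxy, $A\in\mathcal A$ the treatment, $Y\in\mathbb R$ the outcome, with potential outcomes $Y(a,z)$, $W(a,z)$ and $Y(a)=Y(a,Z)$; $U,Z,W$ take values in standard Borel spaces. For a measurable regime $d(X,W,Z)\in\mathcal A$ put $V(d)=\mathbb E[Y(1)\mathbb I\{d=1\}+Y(-1)\mathbb I\{d=-1\}]$. Let $\mathcal D_{\mathcal Z}$ and $\mathcal D_{\mathcal W}$ be the sets of all measurable regimes depending on $(X,Z)$ only, respectively on $(X,W)$ only. Assume: 1. (Standard assumptions) $Y=Y(A,Z)$ and $W=W(A,Z)$; $\mathbb P(A=a\mid U,X)>0$ a.s. for $a\in\mathcal A$; $(Z,A)\perp (Y(a),W)\mid U,X$ for $a\in\mathcal A$. 2. (Completeness of $Z$) For each $a\in\mathcal A$, almost every $x$, and every measurable $g$ with $\mathbb E[g(U)^2\mid X=x]<\infty$: $\mathbb E[g(U)\mid Z,A=a,X=x]=0$ a.s. if and only if $g(U)=0$ a.s. given $X=x$. 3.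 (Outcome bridge) $h(w,a,x)$ is a measurable function with $\mathbb E[Y\mid Z,A,X]=\mathbb E[h(W,A,X)\mid Z,A,X]$ a.s. 4. (Completeness of $W$) The same as 2 with $W$ in place of $Z$. 5. (Treatment bridge) $q(z,a,x)$ is a measurable function with $1/\mathbb P(A=a\mid W,X)=\mathbb E[q(Z,a,X)\mid W,A=a,X]$ a.s. for $a\in\mathcal A$. 6. (Regularity) $|Y|$, $\|h\|_\infty$ and $\|q\|_\infty$ are bounded by a constant, and $\mathbb E[\mathbb P(A=a\mid U,X)^{-2}]<\infty$ for $a\in\mathcal A$. Let $d_z^*\in\arg\max_{d_z\in\mathcal D_{\mathcal Z}}V(d_z)$ and $d_w^*\in\arg\max_{d_w\in\mathcal D_{\mathcal W}}V(d_w)$. For $d_z\in\mathcal D_{\mathcal Z}$, $d_w\in\mathcal D_{\mathcal W}$ put $$\delta(x;d_z,d_w)=\mathbb E[h(W,d_z(X,Z),X)-Yq(Z,A,X)\mathbb I\{d_w(X,W)=A\}\mid X=x],\qquad \bar\pi(x;d_z,d_w)=\mathbb I\{\mathbb E[h(W,d_z(X,Z),X)\mid X=x]\ge\mathbb E[Yq(Z,A,X)\mathbb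 I\{d_w(X,W)=A\}\mid X=x]\},$$ and $d_{zw}^{\bar\pi*}(X,W,Z)=\bar\pi(X;d_z^*,d_w^*)\,d_z^*(X,Z)+(1-\bar\pi(X;d_z^*,d_w^*))\,d_w^*(X,W)$. For each sample size $n$ let $\hat d_z,\hat d_w$ be random regimes in $\mathcal D_{\mathcal Z}$, $\mathcal D_{\mathcal W}$ (depending measurably on the training data) such that, for some $\xi,\varphi>0$ and almost every value $x$ of $X$, $$\mathbb E[h(W,\hat d_z(X,Z),X)\mid X=x]-\mathbb E[h(W,d_z^*(X,Z),X)\mid X=x]=o_p(n^{-\xi}),$$ $$\mathbb E[Yq(Z,A,X)\mathbb I\{\hat d_w(X,W)=A\}\mid X=x]-\mathbb E[Yq(Z,A,X)\mathbb I\{d_w^*(X,W)=A\}\mid X=x]=o_p(n^{-\varphi}),$$ the expectations being over everything except $\hat d_z$ and $\hat d_w$. Let $\hat\delta(x)$ be an estimator of $\delta(x;\hat d_z,\hat d_w)$, and suppose that (a) or (b) holds: * (a) $\hat\delta$ is the Nadaraya--Watson estimator $$\hat\delta(x)=\frac{\sum_{i=1}^n\{\hat h(W_i,\hat d_z(x,Z_i),x)-Y_i\hat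 q(Z_i,A_i,x)\mathbb I\{\hat d_w(x,W_i)=A_i\}\}K(\|x-X_i\|_2/b_n)}{\sum_{i=1}^nK(\|x-X_i\|_2/b_n)}\qquad(0/0=0)$$ from an i.i.d. sample of $(X,W,Z,A,Y)$, with a measurable kernel $K\ge0$, bandwidths $b_n>0$, and estimated bridges with $\sup|\hat h-h|=o_p(n^{-\alpha})$ and $\sup|\hat q-q|=o_p(n^{-\beta})$ for some $\alpha,\beta>0$; $\hat d_z$ and $\hat d_w$ lie in finite non-random classes $\mathcal D_{\mathcal Z,n}\subset\mathcal D_{\mathcal Z}$ and $\mathcal D_{\mathcal W,n}\subset\mathcal D_{\mathcal W}$ of $o(n)$ elements; and for some $C,\gamma>0$, for all $n\ge1$ and each $d_z\in\mathcal D_{\mathcal Z,n}$, $d_w\in\mathcal D_{\mathcal W,n}$, with probability at least $1-1/n$, $\sup_x|\delta(x;d_z,d_w)-\delta'(x;d_z,d_w)|\le Cn^{-\gamma}$, where $\delta'(\cdot;d_z,d_w)$ is the estimator above with $h,q,d_z,d_w$ in place of $\hat h,\hat q,\hat d_z,\hat d_w$; * (b) $\hat\delta$ is any estimator with $\sup_x|\hat\delta(x)-\delta(x;\hat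 d_z,\hat d_w)|\to0$ in probability. Here a supremum over $x$ alone is the essential supremum for the law of $X$. Put $\hat\pi(x)=\mathbb I\{\hat\delta(x)\ge0\}$ and $\hat d_{zw}^{\hat\pi}(X,W,Z)=\hat\pi(X)\hat d_z(X,Z)+(1-\hat\pi(X))\hat d_w(X,W)$. **Claim (consistency).** As $n\to\infty$, $V(\hat d_{zw}^{\hat\pi})\xrightarrow{p}V(d_{zw}^{\bar\pi*})$, where $V(\hat d_{zw}^{\hat\pi})$ is the value, in the population, of the regime learned from the training data. -/

import Mathlib

open MeasureTheory ProbabilityTheory Filter Topology Asymptotics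

noncomputable section

/-- Treatments are the two elements `1` and `-1` of `ℤˣ`; every set of treatments is measurable. -/
instance instDiscreteMeasurableSpaceTreatment : DiscreteMeasurableSpace ℤˣ where
  forall_measurableSet s :=
    ⟨Units.val '' s, MeasurableSet.of_discrete, Set.preimage_image_eq s Units.val_injective⟩

/-- The variables of the proximal causal model, as random variables on `Ω`: latent confounder `U`,
covariates `X`, outcome proxy `W`, treatment proxy `Z`, treatment `A`, outcome `Y`, and the
potential outcomes `Y(a,z)` and `W(a,z)`. No causal assumption is made here. -/
structure ProximalModel (Ω 𝒰 𝒳 𝒲 𝒵 : Type*) [MeasurableSpace Ω] [MeasurableSpace 𝒰]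
    [MeasurableSpace 𝒳] [MeasurableSpace 𝒲] [MeasurableSpace 𝒵] where
  U : Ω → 𝒰
  X : Ω → 𝒳
  W : Ω → 𝒲
  Z : Ω → 𝒵
  A : Ω → ℤˣ
  Y : Ω → ℝ
  Ypot : ℤˣ → 𝒵 → Ω → ℝ
  Wpot : ℤˣ → 𝒵 → Ω → 𝒲
  measurable_U : Measurable U
  measurable_X : Measurable X
  measurable_W : Measurable W
  measurable_Z : Measurable Z
  measurable_A : Measurable A
  measurable_Y : Measurable Y
  measurable_Ypot : ∀ a, Measurable fun ω => Ypot a (Z ω) ω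

namespace ProximalModel

section General

variable {Ω 𝒰 𝒳 𝒲 𝒵 : Type*} [MeasurableSpace Ω] [MeasurableSpace 𝒰]
  [MeasurableSpace 𝒳] [MeasurableSpace 𝒲] [MeasurableSpace 𝒵]

/-- The potential outcome `Y(a) = Y(a, Z)` under the intervention that sets only the treatment. -/
def Ya (M : ProximalModel Ω 𝒰 𝒳 𝒲 𝒵) (a : ℤˣ) (ω : Ω) : ℝ := M.Ypot a (M.Z ω) ω

/-- The σ-algebra generated by `(U, X)`. -/
abbrev sigmaUX (M : ProximalModel Ω 𝒰 𝒳 𝒲 𝒵) : MeasurableSpace Ω :=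
  MeasurableSpace.comap (fun ω => (M.U ω, M.X ω)) inferInstance

/-- The σ-algebra generated by `(W, X)`. -/
abbrev sigmaWX (M : ProximalModel Ω 𝒰 𝒳 𝒲 𝒵) : MeasurableSpace Ω :=
  MeasurableSpace.comap (fun ω => (M.W ω, M.X ω)) inferInstance

/-- The σ-algebra generated by `(Z, A, X)`. -/
abbrev sigmaZAX (M : ProximalModel Ω 𝒰 𝒳 𝒲 𝒵) : MeasurableSpace Ω :=
  MeasurableSpace.comap (fun ω => (M.Z ω, M.A ω, M.X ω)) inferInstance

theorem sigmaUX_le (M : ProximalModel Ω 𝒰 𝒳 𝒲 𝒵) : M.sigmaUX ≤ ‹MeasurableSpace Ω› :=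
  (M.measurable_U.prodMk M.measurable_X).comap_le

/-- The latent propensity score `P(A = a | U, X)`. -/
def propensityUX (M : ProximalModel Ω 𝒰 𝒳 𝒲 𝒵) (μ : Measure Ω) (a : ℤˣ) : Ω → ℝ :=
  μ[(M.A ⁻¹' {a}).indicator (fun _ => (1 : ℝ)) | M.sigmaUX]

/-- The propensity score `P(A = a | W, X)`. -/
def propensityWX (M : ProximalModel Ω 𝒰 𝒳 𝒲 𝒵) (μ : Measure Ω) (a : ℤˣ) : Ω → ℝ :=
  μ[(M.A ⁻¹' {a}).indicator (fun _ => (1 : ℝ)) | M.sigmaWX]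

/-- Consistency, positivity and latent unconfoundedness. -/
structure StandardAssumptions [StandardBorelSpace Ω] (M : ProximalModel Ω 𝒰 𝒳 𝒲 𝒵)
    (μ : Measure Ω) [IsFiniteMeasure μ] : Prop where
  consistency_Y : ∀ᵐ ω ∂μ, M.Y ω = M.Ypot (M.A ω) (M.Z ω) ω
  consistency_W : ∀ᵐ ω ∂μ, M.W ω = M.Wpot (M.A ω) (M.Z ω) ω
  positivity : ∀ a, ∀ᵐ ω ∂μ, 0 < M.propensityUX μ a ω
  unconfounded : ∀ a, CondIndepFun M.sigmaUX M.sigmaUX_le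
    (fun ω => (M.Z ω, M.A ω)) (fun ω => (M.Ya a ω, M.W ω)) μ

/-- `h` is an outcome confounding bridge: `E[Y | Z, A, X] = E[h(W, A, X) | Z, A, X]` a.s. -/
def IsOutcomeBridge (M : ProximalModel Ω 𝒰 𝒳 𝒲 𝒵) (μ : Measure Ω)
    (h : 𝒲 × ℤˣ × 𝒳 → ℝ) : Prop :=
  Measurable h ∧
    μ[M.Y | M.sigmaZAX] =ᵐ[μ] μ[fun ω => h (M.W ω, M.A ω, M.X ω) | M.sigmaZAX]

/-- `q` is a treatment confounding bridge: `1 / P(A = a | W, X) = E[q(Z, a, X) | W, A = a, X]` a.s.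
for both `a`. The right-hand side is the conditional expectation given `(W, X)` under the
conditional probability `P(· | A = a)`. -/
def IsTreatmentBridge (M : ProximalModel Ω 𝒰 𝒳 𝒲 𝒵) (μ : Measure Ω)
    (q : 𝒵 × ℤˣ × 𝒳 → ℝ) : Prop :=
  Measurable q ∧ ∀ a : ℤˣ,
    (fun ω => 1 / M.propensityWX μ a ω) =ᵐ[μ[|M.A ⁻¹' {a}]]
      (μ[|M.A ⁻¹' {a}])[fun ω => q (M.Z ω, a, M.X ω) | M.sigmaWX]

/-- The value `V(d) = E[Y(1) 1{d = 1} + Y(-1) 1{d = -1}]` of a regime `d(X, W, Z)`. -/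
def value (M : ProximalModel Ω 𝒰 𝒳 𝒲 𝒵) (μ : Measure Ω) (d : 𝒳 × 𝒲 × 𝒵 → ℤˣ) : ℝ :=
  ∫ ω, (M.Ya 1 ω * (if d (M.X ω, M.W ω, M.Z ω) = 1 then 1 else 0) +
    M.Ya (-1) ω * (if d (M.X ω, M.W ω, M.Z ω) = -1 then 1 else 0)) ∂μ

/-- `d` maximizes the value over all measurable regimes that map `(X, Z)` to a treatment. -/
def IsOptimalZ (M : ProximalModel Ω 𝒰 𝒳 𝒲 𝒵) (μ : Measure Ω) (d : 𝒳 × 𝒵 → ℤˣ) : Prop :=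
  Measurable d ∧ ∀ d' : 𝒳 × 𝒵 → ℤˣ, Measurable d' →
    M.value μ (fun v => d' (v.1, v.2.2)) ≤ M.value μ (fun v => d (v.1, v.2.2))

/-- `d` maximizes the value over all measurable regimes that map `(X, W)` to a treatment. -/
def IsOptimalW (M : ProximalModel Ω 𝒰 𝒳 𝒲 𝒵) (μ : Measure Ω) (d : 𝒳 × 𝒲 → ℤˣ) : Prop :=
  Measurable d ∧ ∀ d' : 𝒳 × 𝒲 → ℤˣ, Measurable d' →
    M.value μ (fun v => d' (v.1, v.2.1)) ≤ M.value μ (fun v => d (v.1, v.2.1))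

/-- The regime `π(X) d_z(X, Z) + (1 - π(X)) d_w(X, W)`, for `π` with the two values
`true` (for `1`) and `false` (for `0`). -/
def combine (π : 𝒳 → Bool) (dz : 𝒳 × 𝒵 → ℤˣ) (dw : 𝒳 × 𝒲 → ℤˣ) : 𝒳 × 𝒲 × 𝒵 → ℤˣ :=
  fun v => if π v.1 then dz (v.1, v.2.2) else dw (v.1, v.2.1)

variable [StandardBorelSpace 𝒲] [StandardBorelSpace 𝒵] [Nonempty 𝒲] [Nonempty 𝒵]

/-- The regular conditional distribution of `(W, Z, A, Y)` given `X = x`. -/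
def condLaw (M : ProximalModel Ω 𝒰 𝒳 𝒲 𝒵) (μ : Measure Ω) [IsFiniteMeasure μ] :
    Kernel 𝒳 (𝒲 × 𝒵 × ℤˣ × ℝ) :=
  condDistrib (fun ω => (M.W ω, M.Z ω, M.A ω, M.Y ω)) M.X μ

/-- `E[h(W, d_z(X, Z), X) | X = x]`. -/
def meanZ (M : ProximalModel Ω 𝒰 𝒳 𝒲 𝒵) (μ : Measure Ω) [IsFiniteMeasure μ]
    (h : 𝒲 × ℤˣ × 𝒳 → ℝ) (dz : 𝒳 × 𝒵 → ℤˣ) (x : 𝒳) : ℝ :=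
  ∫ o, h (o.1, dz (x, o.2.1), x) ∂(M.condLaw μ x)

/-- `E[Y q(Z, A, X) 1{d_w(X, W) = A} | X = x]`. -/
def meanW (M : ProximalModel Ω 𝒰 𝒳 𝒲 𝒵) (μ : Measure Ω) [IsFiniteMeasure μ]
    (q : 𝒵 × ℤˣ × 𝒳 → ℝ) (dw : 𝒳 × 𝒲 → ℤˣ) (x : 𝒳) : ℝ :=
  ∫ o, o.2.2.2 * q (o.2.1, o.2.2.1, x) * (if dw (x, o.1) = o.2.2.1 then 1 else 0)
    ∂(M.condLaw μ x)

/-- `δ(x; d_z, d_w) = E[h(W, d_z(X, Z), X) - Y q(Z, A, X) 1{d_w(X, W) = A} | X = x]`. -/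
def delta (M : ProximalModel Ω 𝒰 𝒳 𝒲 𝒵) (μ : Measure Ω) [IsFiniteMeasure μ]
    (h : 𝒲 × ℤˣ × 𝒳 → ℝ) (q : 𝒵 × ℤˣ × 𝒳 → ℝ) (dz : 𝒳 × 𝒵 → ℤˣ) (dw : 𝒳 × 𝒲 → ℤˣ)
    (x : 𝒳) : ℝ :=
  ∫ o, (h (o.1, dz (x, o.2.1), x) -
    o.2.2.2 * q (o.2.1, o.2.2.1, x) * (if dw (x, o.1) = o.2.2.1 then 1 else 0))
    ∂(M.condLaw μ x)

open Classical in
/-- `π̄(x; d_z, d_w)`: whether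
`E[h(W, d_z(X, Z), X) | X = x] ≥ E[Y q(Z, A, X) 1{d_w(X, W) = A} | X = x]`. -/
def piBar (M : ProximalModel Ω 𝒰 𝒳 𝒲 𝒵) (μ : Measure Ω) [IsFiniteMeasure μ]
    (h : 𝒲 × ℤˣ × 𝒳 → ℝ) (q : 𝒵 × ℤˣ × 𝒳 → ℝ) (dz : 𝒳 × 𝒵 → ℤˣ) (dw : 𝒳 × 𝒲 → ℤˣ)
    (x : 𝒳) : Bool :=
  decide (M.meanW μ q dw x ≤ M.meanZ μ h dz x)

end General

end ProximalModel

/-- Completeness of the proxy `T` for the latent `U`: for both treatments `a` and almost every value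
`x` of `X`, every square-integrable `g` satisfies `E[g(U) | T, A = a, X = x] = 0` a.s. if and only
if `g(U) = 0` a.s. Here `Q x` is the law of `(U, T, A)` given `X = x`. -/
def ProxyComplete {Ω 𝒰 𝒳 𝒯 : Type*} [MeasurableSpace Ω] [MeasurableSpace 𝒰] [MeasurableSpace 𝒳]
    [MeasurableSpace 𝒯] [StandardBorelSpace 𝒰] [StandardBorelSpace 𝒯] [Nonempty 𝒰] [Nonempty 𝒯]
    (μ : Measure Ω) [IsFiniteMeasure μ] (U : Ω → 𝒰) (T : Ω → 𝒯) (A : Ω → ℤˣ) (X : Ω → 𝒳) : Prop :=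
  let Q : Kernel 𝒳 (𝒰 × 𝒯 × ℤˣ) := condDistrib (fun ω => (U ω, T ω, A ω)) X μ
  ∀ a : ℤˣ, ∀ᵐ x ∂(μ.map X), ∀ g : 𝒰 → ℝ, Measurable g →
    MemLp (fun s : 𝒰 × 𝒯 × ℤˣ => g s.1) 2 (Q x) →
    (((Q x)[|{s | s.2.2 = a}])[fun s : 𝒰 × 𝒯 × ℤˣ => g s.1 |
          MeasurableSpace.comap (fun s : 𝒰 × 𝒯 × ℤˣ => s.2.1) inferInstance]
        =ᵐ[(Q x)[|{s | s.2.2 = a}]] 0 ↔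
      (fun s : 𝒰 × 𝒯 × ℤˣ => g s.1) =ᵐ[Q x] 0)

/-- `R n = o_p(r n)` under the probability `P`. -/
def IsLittleOInProb {Ξ : Type*} [MeasurableSpace Ξ] (P : Measure Ξ)
    (R : ℕ → Ξ → ℝ) (r : ℕ → ℝ) : Prop :=
  ∀ ε : ℝ, 0 < ε → Tendsto (fun n => P {ξ | ε * r n < |R n ξ|}) atTop (𝓝 0)

/-- `sup_i |R n ξ i| = o_p(r n)` under the probability `P`. -/
def SupIsLittleOInProb {Ξ ι : Type*} [MeasurableSpace Ξ] (P : Measure Ξ)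
    (R : ℕ → Ξ → ι → ℝ) (r : ℕ → ℝ) : Prop :=
  ∀ ε : ℝ, 0 < ε → Tendsto (fun n => P {ξ | ∃ i, ε * r n < |R n ξ i|}) atTop (𝓝 0)

/-- The Nadaraya-Watson kernel regression with kernel `K`, bandwidth `b`, bridges `h` and `q` and
regimes `dz` and `dw`, from the `n` observations `S i = (X_i, W_i, Z_i, A_i, Y_i)`, `i < n`. -/
def nadarayaWatson {p : ℕ} {𝒲 𝒵 : Type*} (K : ℝ → ℝ) (b : ℝ) (n : ℕ)
    (h : 𝒲 × ℤˣ × EuclideanSpace ℝ (Fin p) → ℝ) (q : 𝒵 × ℤˣ × EuclideanSpace ℝ (Fin p) → ℝ)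
    (dz : EuclideanSpace ℝ (Fin p) × 𝒵 → ℤˣ) (dw : EuclideanSpace ℝ (Fin p) × 𝒲 → ℤˣ)
    (S : ℕ → EuclideanSpace ℝ (Fin p) × 𝒲 × 𝒵 × ℤˣ × ℝ) (x : EuclideanSpace ℝ (Fin p)) : ℝ :=
  (∑ i ∈ Finset.range n, match S i with
    | (Xi, Wi, Zi, Ai, Yi) =>
      (h (Wi, dz (x, Zi), x) - Yi * q (Zi, Ai, x) * (if dw (x, Wi) = Ai then 1 else 0)) *
        K (‖x - Xi‖ / b)) /
    ∑ i ∈ Finset.range n, K (‖x - (S i).1‖ / b)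

namespace ProximalModel

/-- `deltaHat` is a generic estimator of `δ(·; dzHat, dwHat)` that is uniformly consistent:
`sup_x |deltaHat(x) - δ(x; dzHat, dwHat)| → 0` in probability. As `δ` is a conditional expectation
given `X = x`, the supremum is the essential supremum for the law of `X`. -/
def IsUniformlyConsistent {Ω 𝒰 𝒳 𝒲 𝒵 Ξ : Type*} [MeasurableSpace Ω] [MeasurableSpace 𝒰]
    [MeasurableSpace 𝒳] [MeasurableSpace 𝒲] [MeasurableSpace 𝒵] [MeasurableSpace Ξ]
    [StandardBorelSpace 𝒲] [StandardBorelSpace 𝒵] [Nonempty 𝒲] [Nonempty 𝒵]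
    (M : ProximalModel Ω 𝒰 𝒳 𝒲 𝒵) (μ : Measure Ω) [IsFiniteMeasure μ] (P : Measure Ξ)
    (h : 𝒲 × ℤˣ × 𝒳 → ℝ) (q : 𝒵 × ℤˣ × 𝒳 → ℝ)
    (dzHat : ℕ → Ξ → 𝒳 × 𝒵 → ℤˣ) (dwHat : ℕ → Ξ → 𝒳 × 𝒲 → ℤˣ)
    (deltaHat : ℕ → Ξ → 𝒳 → ℝ) : Prop :=
  (∀ n, Measurable fun s : Ξ × 𝒳 => deltaHat n s.1 s.2) ∧
  ∀ ε : ℝ, 0 < ε → Tendsto (fun n => P {ξ | ¬ ∀ᵐ x ∂(μ.map M.X),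
    |deltaHat n ξ x - M.delta μ h q (dzHat n ξ) (dwHat n ξ) x| ≤ ε}) atTop (𝓝 0)

/-- `deltaHat` is the Nadaraya-Watson estimator of `δ(·; dzHat, dwHat)` built from an i.i.d. sample
`S` and the estimated bridges `hHat`, `qHat`, where
* the kernel `K` is nonnegative and the bandwidths `b n` are positive;
* `sup |hHat - h| = o_p(n ^ (-α))` and `sup |qHat - q| = o_p(n ^ (-β))`;
* the preliminary regimes are chosen from finite classes `DZ n`, `DW n` of `o(n)` regimes;
* for each fixed pair of regimes from these classes the oracle estimator, which uses `h` and `q`,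
  is within `C * n ^ (-γ)` of `δ`, uniformly in `x`, with probability at least `1 - 1 / n`. -/
structure IsNadarayaWatson {p : ℕ} {Ω 𝒰 𝒲 𝒵 Ξ : Type*} [MeasurableSpace Ω] [MeasurableSpace 𝒰]
    [MeasurableSpace 𝒲] [MeasurableSpace 𝒵] [MeasurableSpace Ξ]
    [StandardBorelSpace 𝒲] [StandardBorelSpace 𝒵] [Nonempty 𝒲] [Nonempty 𝒵]
    (M : ProximalModel Ω 𝒰 (EuclideanSpace ℝ (Fin p)) 𝒲 𝒵) (μ : Measure Ω) [IsFiniteMeasure μ]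
    (P : Measure Ξ)
    (h : 𝒲 × ℤˣ × EuclideanSpace ℝ (Fin p) → ℝ) (q : 𝒵 × ℤˣ × EuclideanSpace ℝ (Fin p) → ℝ)
    (dzHat : ℕ → Ξ → EuclideanSpace ℝ (Fin p) × 𝒵 → ℤˣ)
    (dwHat : ℕ → Ξ → EuclideanSpace ℝ (Fin p) × 𝒲 → ℤˣ)
    (deltaHat : ℕ → Ξ → EuclideanSpace ℝ (Fin p) → ℝ)
    (S : ℕ → Ξ → EuclideanSpace ℝ (Fin p) × 𝒲 × 𝒵 × ℤˣ × ℝ)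
    (hHat : ℕ → Ξ → 𝒲 × ℤˣ × EuclideanSpace ℝ (Fin p) → ℝ)
    (qHat : ℕ → Ξ → 𝒵 × ℤˣ × EuclideanSpace ℝ (Fin p) → ℝ)
    (K : ℝ → ℝ) (b : ℕ → ℝ)
    (DZ : ℕ → Set (EuclideanSpace ℝ (Fin p) × 𝒵 → ℤˣ))
    (DW : ℕ → Set (EuclideanSpace ℝ (Fin p) × 𝒲 → ℤˣ))
    (α β γ C : ℝ) : Prop where
  measurable_S : ∀ i, Measurable (S i)
  indep : iIndepFun S P
  identDistrib : ∀ i,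
    IdentDistrib (S i) (fun ω => (M.X ω, M.W ω, M.Z ω, M.A ω, M.Y ω)) P μ
  measurable_K : Measurable K
  K_nonneg : ∀ t, 0 ≤ K t
  b_pos : ∀ n, 0 < b n
  measurable_hHat : ∀ n,
    Measurable fun s : Ξ × (𝒲 × ℤˣ × EuclideanSpace ℝ (Fin p)) => hHat n s.1 s.2
  measurable_qHat : ∀ n,
    Measurable fun s : Ξ × (𝒵 × ℤˣ × EuclideanSpace ℝ (Fin p)) => qHat n s.1 s.2
  deltaHat_eq : ∀ n ξ x, deltaHat n ξ x =
    nadarayaWatson K (b n) n (hHat n ξ) (qHat n ξ) (dzHat n ξ) (dwHat n ξ) (fun i => S i ξ) x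
  α_pos : 0 < α
  β_pos : 0 < β
  γ_pos : 0 < γ
  C_pos : 0 < C
  rate_hHat : SupIsLittleOInProb P (fun n ξ v => hHat n ξ v - h v) (fun n => (n : ℝ) ^ (-α))
  rate_qHat : SupIsLittleOInProb P (fun n ξ v => qHat n ξ v - q v) (fun n => (n : ℝ) ^ (-β))
  measurable_DZ : ∀ n, ∀ d ∈ DZ n, Measurable d
  measurable_DW : ∀ n, ∀ d ∈ DW n, Measurable d
  finite_DZ : ∀ n, (DZ n).Finite
  finite_DW : ∀ n, (DW n).Finite
  card_DZ : (fun n => ((DZ n).ncard : ℝ)) =o[atTop] (fun n => (n : ℝ))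
  card_DW : (fun n => ((DW n).ncard : ℝ)) =o[atTop] (fun n => (n : ℝ))
  dzHat_mem : ∀ n ξ, dzHat n ξ ∈ DZ n
  dwHat_mem : ∀ n ξ, dwHat n ξ ∈ DW n
  oracle : ∀ n, 1 ≤ n → ∀ dz ∈ DZ n, ∀ dw ∈ DW n,
    P {ξ | ¬ ∀ᵐ x ∂(μ.map M.X),
      |M.delta μ h q dz dw x - nadarayaWatson K (b n) n h q dz dw (fun i => S i ξ) x|
        ≤ C * (n : ℝ) ^ (-γ)} ≤ ENNReal.ofReal (1 / (n : ℝ))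

end ProximalModel

end

/-! The value of a combined regime is an integral over `x` of either `meanZ` or `meanW`, according
to the selector (`value_combine`). The selector depends on `X` alone, so the events `{π = 1, d_z =
a}` and `{π = 0, d_w = a}` are determined by `(X, Z)` and `(X, W)` respectively. The outcome bridge
handles the former (`integral_mul_Ya`), the treatment bridge the latter
(`integral_weightedTreat_mul_Ya`). Each bridge equation concerns observables only. Conditional
independence turns it into the vanishing of integrals of a function of `(U, X)` over proxy events
among the treated, and completeness (`ProxyComplete.ae_eq_zero`) makes that function vanish almost
surely, which gives the bridge identity at the latent level.

After identification, the target regime collects `max(meanZ, meanW)` at the optimal regimes. The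
learned selector uses the sign of an approximation of `meanZ - meanW` at the estimated regimes. A
wrong sign can occur only where the two means differ by at most the approximation error, so the loss
is bounded by the errors themselves (`abs_ite_sub_ite_le`), and no margin condition near `δ = 0` is
needed. The errors of the two means tend to zero in probability for almost every `x` and are
bounded, hence so do their integrals (`tendsto_measure_integral_abs`).

The Nadaraya-Watson case reduces to uniform consistency (`IsNadarayaWatson.isUniformlyConsistent`).
Estimated bridges cost at most a multiple of their sup errors, because the estimator is a weighted
average. The randomness of the regimes is absorbed by a union bound. A bound over all pairs would
involve `o(n²)` events of probability `1/n`, which is too many. Both the contrast and its estimator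
are a function of `d_z` plus a function of `d_w`, so it suffices to vary one regime at a time
against a fixed reference, which involves only `o(n)` events. -/

set_option linter.unusedSectionVars false

/-! ### Products of conditionally independent variables. -/

section CondIndep

variable {Ω β β' γ : Type*} [MeasurableSpace Ω] [StandardBorelSpace Ω]
  [MeasurableSpace β] [StandardBorelSpace β] [Nonempty β]
  [MeasurableSpace β'] [StandardBorelSpace β'] [Nonempty β'] [MeasurableSpace γ]
  {μ : Measure Ω} [IsFiniteMeasure μ] {k : Ω → γ} {f : Ω → β} {g : Ω → β'}

/-- The expectation of a product of functions of conditionally independent variables is the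
expectation of the product of the conditional expectations. -/
theorem integral_mul_eq_of_condIndepFun (hf : Measurable f) (hg : Measurable g) (hk : Measurable k)
    (hind : f ⟂ᵢ[k, hk; μ] g) {φ : γ × β → ℝ} {ψ : γ × β' → ℝ} (hφ : Measurable φ)
    (hψ : Measurable ψ) (hint : Integrable (fun ω => φ (k ω, f ω) * ψ (k ω, g ω)) μ) :
    ∫ ω, φ (k ω, f ω) * ψ (k ω, g ω) ∂μ =
      ∫ c, (∫ b, φ (c, b) ∂(condDistrib f k μ c)) * (∫ b, ψ (c, b) ∂(condDistrib g k μ c))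
        ∂(μ.map k) := by
  -- Conditional independence says that, given `k`, the joint law of `f` and `g` is a product
  -- kernel. The claim is then disintegration followed by Fubini.
  have hlaw := (condIndepFun_iff_map_prod_eq_prod_condDistrib_prod_condDistrib hf hg hk).1 hind
  rw [← Measure.compProd_eq_comp_prod] at hlaw
  have hm : Measurable fun ω => (k ω, f ω, g ω) := hk.prodMk (hf.prodMk hg)
  have hF : Measurable fun p : γ × β × β' => φ (p.1, p.2.1) * ψ (p.1, p.2.2) := by fun_prop
  have hint' : Integrable (fun p : γ × β × β' => φ (p.1, p.2.1) * ψ (p.1, p.2.2))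
      (μ.map k ⊗ₘ (condDistrib f k μ ×ₖ condDistrib g k μ)) := by
    rw [← hlaw]
    exact (integrable_map_measure hF.aestronglyMeasurable hm.aemeasurable).2 hint
  calc ∫ ω, φ (k ω, f ω) * ψ (k ω, g ω) ∂μ
      = ∫ p, φ (p.1, p.2.1) * ψ (p.1, p.2.2) ∂(μ.map fun ω => (k ω, f ω, g ω)) :=
        (integral_map hm.aemeasurable hF.aestronglyMeasurable).symm
    _ = _ := by
        rw [hlaw, Measure.integral_compProd hint']
        refine integral_congr_ae (Eventually.of_forall fun c => ?_)
        simp only [Kernel.prod_apply]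
        exact integral_prod_mul (fun b => φ (c, b)) fun b => ψ (c, b)

/-- Replace the left factor by its conditional expectation. -/
theorem integral_mul_eq_integral_condDistrib_mul (hf : Measurable f) (hg : Measurable g)
    (hk : Measurable k) (hind : f ⟂ᵢ[k, hk; μ] g) {φ : γ × β → ℝ} {ψ : γ × β' → ℝ}
    (hφ : Measurable φ) (hψ : Measurable ψ)
    (hint : Integrable (fun ω => φ (k ω, f ω) * ψ (k ω, g ω)) μ)
    (hint' : Integrable
      (fun ω => (∫ b, φ (k ω, b) ∂(condDistrib f k μ (k ω))) * ψ (k ω, g ω)) μ) :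
    ∫ ω, φ (k ω, f ω) * ψ (k ω, g ω) ∂μ =
      ∫ ω, (∫ b, φ (k ω, b) ∂(condDistrib f k μ (k ω))) * ψ (k ω, g ω) ∂μ := by
  have hφ' : Measurable fun c => ∫ b, φ (c, b) ∂(condDistrib f k μ c) :=
    (StronglyMeasurable.integral_condDistrib hφ.stronglyMeasurable).measurable
  -- The product formula is applied again to the averaged factor, which is constant in `b`. Both
  -- sides of the goal thus reduce to the same integral over the law of `k`.
  have := integral_mul_eq_of_condIndepFun hf hg hk hind
    (φ := fun p => ∫ b, φ (p.1, b) ∂(condDistrib f k μ p.1)) (hφ'.comp measurable_fst) hψ hint'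
  rw [integral_mul_eq_of_condIndepFun hf hg hk hind hφ hψ hint, this]
  simp

/-- Replace the right factor by its conditional expectation. -/
theorem integral_mul_eq_integral_mul_condDistrib (hf : Measurable f) (hg : Measurable g)
    (hk : Measurable k) (hind : f ⟂ᵢ[k, hk; μ] g) {φ : γ × β → ℝ} {ψ : γ × β' → ℝ}
    (hφ : Measurable φ) (hψ : Measurable ψ)
    (hint : Integrable (fun ω => φ (k ω, f ω) * ψ (k ω, g ω)) μ)
    (hint' : Integrable
      (fun ω => φ (k ω, f ω) * ∫ b, ψ (k ω, b) ∂(condDistrib g k μ (k ω))) μ) :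
    ∫ ω, φ (k ω, f ω) * ψ (k ω, g ω) ∂μ =
      ∫ ω, φ (k ω, f ω) * ∫ b, ψ (k ω, b) ∂(condDistrib g k μ (k ω)) ∂μ := by
  have hψ' : Measurable fun c => ∫ b, ψ (c, b) ∂(condDistrib g k μ c) :=
    (StronglyMeasurable.integral_condDistrib hψ.stronglyMeasurable).measurable
  have := integral_mul_eq_of_condIndepFun hf hg hk hind hφ
    (ψ := fun p => ∫ b, ψ (p.1, b) ∂(condDistrib g k μ p.1)) (hψ'.comp measurable_fst) hint'
  rw [integral_mul_eq_of_condIndepFun hf hg hk hind hφ hψ hint, this]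
  simp

end CondIndep

/-! ### From slicewise completeness to an almost sure statement. -/

section Completeness

/-- Dynkin's π-λ argument. The whole space enters as a separate hypothesis because the π-system need
not contain it, and complements require it. -/
theorem setIntegral_preimage_eq_zero_of_generateFrom {α 𝒯 : Type*} [MeasurableSpace α]
    [m : MeasurableSpace 𝒯] {ν : Measure α} {f : α → ℝ} (hf : Integrable f ν) {T : α → 𝒯}
    (hT : Measurable T) {s : Set (Set 𝒯)} (hs : m = MeasurableSpace.generateFrom s)
    (hpi : IsPiSystem s) (huniv : ∫ a, f a ∂ν = 0) (hzero : ∀ t ∈ s, ∫ a in T ⁻¹' t, f a ∂ν = 0)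
    {t : Set 𝒯} (ht : MeasurableSet t) : ∫ a in T ⁻¹' t, f a ∂ν = 0 := by
  induction t, ht using MeasurableSpace.induction_on_inter hs hpi with
  | empty => simp
  | basic t ht => exact hzero t ht
  | compl t ht ih => rw [Set.preimage_compl, setIntegral_compl (hT ht) hf, ih, huniv, sub_zero]
  | iUnion u hd hm ih =>
    rw [Set.preimage_iUnion, integral_iUnion (fun i => hT (hm i))
      (fun i j hij => (hd hij).preimage T) hf.integrableOn]
    simp [ih]

theorem setIntegral_cond {α : Type*} [MeasurableSpace α] (ν : Measure α) {s t : Set α}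
    (ht : MeasurableSet t) (f : α → ℝ) :
    ∫ a in t, f a ∂(ν[|s]) = ((ν s)⁻¹).toReal * ∫ a in t ∩ s, f a ∂ν := by
  rw [ProbabilityTheory.cond, Measure.restrict_smul, integral_smul_measure,
    Measure.restrict_restrict ht, smul_eq_mul]

theorem integrable_cond {α : Type*} [MeasurableSpace α] {ν : Measure α} (s : Set α) {f : α → ℝ}
    (hf : Integrable f ν) : Integrable f (ν[|s]) := by
  by_cases h0 : ν s = 0
  · simp [cond_eq_zero_of_meas_eq_zero h0]
  · exact hf.restrict.smul_measure (ENNReal.inv_ne_top.2 h0)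

variable {Ω 𝒰 𝒳 𝒯 : Type*} [MeasurableSpace Ω] [MeasurableSpace 𝒰] [MeasurableSpace 𝒳]
    [MeasurableSpace 𝒯] [StandardBorelSpace 𝒰] [StandardBorelSpace 𝒯] [Nonempty 𝒰] [Nonempty 𝒯]
    {μ : Measure Ω} [IsFiniteMeasure μ] {U : Ω → 𝒰} {T : Ω → 𝒯} {A : Ω → ℤˣ} {X : Ω → 𝒳}

open MeasurableSpace in
/-- The σ-algebra of a standard Borel space is generated by a countable π-system. -/
theorem exists_countable_piSystem (𝒯 : Type*) [m : MeasurableSpace 𝒯] [StandardBorelSpace 𝒯] :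
    ∃ s : ℚ → Set 𝒯, m = generateFrom (Set.range s) ∧ IsPiSystem (Set.range s) := by
  let e := embeddingReal 𝒯
  have he : MeasurableEmbedding e := measurableEmbedding_embeddingReal 𝒯
  refine ⟨fun r => e ⁻¹' Set.Iic (r : ℝ), ?_, ?_⟩
  · rw [← he.comap_eq, BorelSpace.measurable_eq (α := ℝ), Real.borel_eq_generateFrom_Iic_rat,
      comap_generateFrom, Set.iUnion_singleton_eq_range, ← Set.range_comp]
    rfl
  · rintro _ ⟨r, rfl⟩ _ ⟨r', rfl⟩ -
    exact ⟨min r r', by ext; simp⟩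

/-- Completeness of a proxy in terms of unconditional integrals: if `r(U, X)` integrates to zero over
every event `{X ∈ B, T ∈ C, A = a}`, then `r(U, X) = 0` a.s. -/
theorem ProxyComplete.ae_eq_zero (hc : ProxyComplete μ U T A X) (hU : Measurable U)
    (hT : Measurable T) (hA : Measurable A) (hX : Measurable X) {r : 𝒰 × 𝒳 → ℝ}
    (hr : Measurable r) (hL : MemLp (fun ω => r (U ω, X ω)) 2 μ) (a : ℤˣ)
    (hz : ∀ B : Set 𝒳, MeasurableSet B → ∀ C : Set 𝒯, MeasurableSet C →
      ∫ ω in {ω | X ω ∈ B ∧ T ω ∈ C ∧ A ω = a}, r (U ω, X ω) ∂μ = 0) :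
    ∀ᵐ ω ∂μ, r (U ω, X ω) = 0 := by
  have hV : Measurable fun ω => (U ω, T ω, A ω) := hU.prodMk (hT.prodMk hA)
  set Q : Kernel 𝒳 (𝒰 × 𝒯 × ℤˣ) := condDistrib (fun ω => (U ω, T ω, A ω)) X μ with hQ
  have hlaw : μ.map X ⊗ₘ Q = μ.map fun ω => (X ω, U ω, T ω, A ω) :=
    compProd_map_condDistrib hV.aemeasurable
  have hXV : Measurable fun ω => (X ω, U ω, T ω, A ω) := hX.prodMk hV
  let R : 𝒳 × 𝒰 × 𝒯 × ℤˣ → ℝ := fun p => r (p.2.1, p.1)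
  have hR : Measurable R := by fun_prop
  have hRint : Integrable R (μ.map X ⊗ₘ Q) := by
    rw [hlaw, integrable_map_measure hR.aestronglyMeasurable hXV.aemeasurable]
    exact hL.integrable (by norm_num)
  have hRsq : Integrable (fun p => R p ^ 2) (μ.map X ⊗ₘ Q) := by
    rw [hlaw, integrable_map_measure (by fun_prop) hXV.aemeasurable]
    exact hL.integrable_sq
  -- For fixed `C` the slice integral, as a function of `x`, integrates to zero over every `B`, so
  -- it vanishes almost everywhere. The exceptional null set depends on `C`.
  have hslice : ∀ C : Set 𝒯, MeasurableSet C →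
      ∀ᵐ x ∂(μ.map X), ∫ s in {s : 𝒰 × 𝒯 × ℤˣ | s.2.1 ∈ C ∧ s.2.2 = a}, r (s.1, x) ∂(Q x) = 0 := by
    intro C hC
    have hS : MeasurableSet {s : 𝒰 × 𝒯 × ℤˣ | s.2.1 ∈ C ∧ s.2.2 = a} :=
      ((measurable_fst.comp measurable_snd) hC).inter
        ((measurable_snd.comp measurable_snd) (measurableSet_singleton a))
    refine Integrable.ae_eq_zero_of_forall_setIntegral_eq_zero ?_ fun B hB _ => ?_
    · have := ((hlaw ▸ hRint).indicator (MeasurableSet.univ.prod hS)).integral_condDistrib_map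
        hV.aemeasurable
      refine this.congr (Eventually.of_forall fun x => ?_)
      simp only
      rw [← integral_indicator hS]
      refine integral_congr_ae (Eventually.of_forall fun s => ?_)
      by_cases hs : s ∈ {s : 𝒰 × 𝒯 × ℤˣ | s.2.1 ∈ C ∧ s.2.2 = a}
      · rw [Set.indicator_of_mem hs]
        exact Set.indicator_of_mem (Set.mk_mem_prod (Set.mem_univ x) hs) R
      · rw [Set.indicator_of_notMem hs]
        exact Set.indicator_of_notMem (fun h => hs h.2) R
    · rw [← Measure.setIntegral_compProd hB hS hRint.integrableOn (f := R), hlaw,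
        setIntegral_map (hB.prod hS) hR.aestronglyMeasurable hXV.aemeasurable]
      exact hz B hB C hC
  -- A countable generating π-system allows one null set of `x` to serve for every `C` at once.
  obtain ⟨s, hs, hpi⟩ := exists_countable_piSystem 𝒯
  have hkey : ∀ᵐ x ∂(μ.map X), (fun s : 𝒰 × 𝒯 × ℤˣ => r (s.1, x)) =ᵐ[Q x] 0 := by
    filter_upwards [hc a, (hlaw ▸ hRint).condDistrib_ae_map hV.aemeasurable,
      (hlaw ▸ hRsq).condDistrib_ae_map hV.aemeasurable, hslice _ MeasurableSet.univ,
      ae_all_iff.2 fun i => hslice (s i) (by rw [hs]; exact .basic _ ⟨i, rfl⟩)]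
      with x hcx hint hsq huniv hall
    have hsm : StronglyMeasurable fun s : 𝒰 × 𝒯 × ℤˣ => r (s.1, x) := by
      have : Measurable fun s : 𝒰 × 𝒯 × ℤˣ => r (s.1, x) := by fun_prop
      exact this.stronglyMeasurable
    have hmem : MemLp (fun s : 𝒰 × 𝒯 × ℤˣ => r (s.1, x)) 2 (Q x) :=
      (memLp_two_iff_integrable_sq hsm.aestronglyMeasurable).2 hsq
    have hT' : Measurable fun s : 𝒰 × 𝒯 × ℤˣ => s.2.1 := by fun_prop
    have hmap : ∀ C : Set 𝒯, MeasurableSet C →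
        ∫ s in {s : 𝒰 × 𝒯 × ℤˣ | s.2.1 ∈ C ∧ s.2.2 = a}, r (s.1, x) ∂(Q x)
          = ∫ s in (fun s : 𝒰 × 𝒯 × ℤˣ => s.2.1) ⁻¹' C, r (s.1, x)
              ∂((Q x).restrict {s | s.2.2 = a}) := by
      intro C hC
      rw [Measure.restrict_restrict (hT' hC)]
      rfl
    have hC : ∀ C : Set 𝒯, MeasurableSet C →
        ∫ s in {s : 𝒰 × 𝒯 × ℤˣ | s.2.1 ∈ C ∧ s.2.2 = a}, r (s.1, x) ∂(Q x) = 0 := by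
      intro C hC
      rw [hmap C hC]
      refine setIntegral_preimage_eq_zero_of_generateFrom (hmem.integrable (by norm_num)).restrict
        hT' hs hpi ?_ ?_ hC
      · rw [hmap _ MeasurableSet.univ] at huniv
        simpa using huniv
      · rintro _ ⟨i, rfl⟩
        rw [← hmap _ (by rw [hs]; exact .basic _ ⟨i, rfl⟩)]
        exact hall i
    -- Completeness at `x` needs a zero conditional expectation given the proxy under the law
    -- conditioned on `A = a`. The constant `0` has the defining integrals, since conditioning only
    -- rescales the integrals over `{T ∈ C, A = a}`.
    refine (hcx (fun u => r (u, x)) (by fun_prop) hmem).1 ?_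
    refine (ae_eq_condExp_of_forall_setIntegral_eq hT'.comap_le
      (integrable_cond _ (hmem.integrable (by norm_num))) (fun _ _ _ => integrableOn_zero) ?_
      aestronglyMeasurable_zero).symm
    rintro _ ⟨C, hC', rfl⟩ -
    have : ∫ s in (fun s : 𝒰 × 𝒯 × ℤˣ => s.2.1) ⁻¹' C ∩ {s | s.2.2 = a}, r (s.1, x) ∂(Q x) = 0 :=
      hC C hC'
    rw [setIntegral_cond _ (hT' hC'), setIntegral_cond _ (hT' hC'), this]
    simp
  have : ∀ᵐ p ∂(μ.map X ⊗ₘ Q), R p = 0 := by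
    exact (Measure.ae_compProd_iff (hR (measurableSet_singleton 0))).2 hkey
  rw [hlaw] at this
  exact ae_of_ae_map hXV.aemeasurable this

end Completeness

/-! ### Latent propensity score and potential outcomes. -/

namespace ProximalModel

section Identification

variable {Ω 𝒰 𝒳 𝒲 𝒵 : Type*} [MeasurableSpace Ω] [StandardBorelSpace Ω] [MeasurableSpace 𝒰]
  [MeasurableSpace 𝒳] [MeasurableSpace 𝒲] [MeasurableSpace 𝒵]

theorem measurable_Ya (M : ProximalModel Ω 𝒰 𝒳 𝒲 𝒵) (a : ℤˣ) : Measurable (M.Ya a) :=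
  M.measurable_Ypot a

variable [StandardBorelSpace 𝒲] [StandardBorelSpace 𝒵] [Nonempty 𝒲] [Nonempty 𝒵]
  {M : ProximalModel Ω 𝒰 𝒳 𝒲 𝒵} {μ : Measure Ω} [IsProbabilityMeasure μ]
  {h : 𝒲 × ℤˣ × 𝒳 → ℝ} {q : 𝒵 × ℤˣ × 𝒳 → ℝ} {B : ℝ}

theorem measurable_UX (M : ProximalModel Ω 𝒰 𝒳 𝒲 𝒵) : Measurable fun ω => (M.U ω, M.X ω) :=
  M.measurable_U.prodMk M.measurable_X

theorem measurable_ZA (M : ProximalModel Ω 𝒰 𝒳 𝒲 𝒵) : Measurable fun ω => (M.Z ω, M.A ω) :=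
  M.measurable_Z.prodMk M.measurable_A

theorem measurable_YaW (M : ProximalModel Ω 𝒰 𝒳 𝒲 𝒵) (a : ℤˣ) :
    Measurable fun ω => (M.Ya a ω, M.W ω) :=
  (M.measurable_Ya a).prodMk M.measurable_W

/-- The indicator of treatment `a`, as a function of `((u, x), (z, a'))`. -/
def treatInd (𝒰 𝒳 𝒵 : Type*) (a : ℤˣ) (p : (𝒰 × 𝒳) × 𝒵 × ℤˣ) : ℝ := if p.2.2 = a then 1 else 0

theorem measurable_treatInd (a : ℤˣ) : Measurable (treatInd 𝒰 𝒳 𝒵 a) :=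
  Measurable.ite ((measurable_snd.comp measurable_snd) (measurableSet_singleton a))
    measurable_const measurable_const

theorem abs_treatInd_le (a : ℤˣ) (p : (𝒰 × 𝒳) × 𝒵 × ℤˣ) : |treatInd 𝒰 𝒳 𝒵 a p| ≤ 1 := by
  unfold treatInd; split_ifs <;> simp

/-- A version of the latent propensity score, as a function of `(u, x)`. -/
noncomputable def latentPropensity (M : ProximalModel Ω 𝒰 𝒳 𝒲 𝒵) (μ : Measure Ω) [IsFiniteMeasure μ] (a : ℤˣ)
    (c : 𝒰 × 𝒳) : ℝ :=
  ∫ b, treatInd 𝒰 𝒳 𝒵 a (c, b)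
    ∂(condDistrib (fun ω => (M.Z ω, M.A ω)) (fun ω => (M.U ω, M.X ω)) μ c)

theorem measurable_latentPropensity (a : ℤˣ) : Measurable (M.latentPropensity μ a) :=
  (StronglyMeasurable.integral_condDistrib (measurable_treatInd a).stronglyMeasurable).measurable

theorem abs_integral_le_of_forall_abs_le {α : Type*} [MeasurableSpace α] {ν : Measure α}
    [IsProbabilityMeasure ν] {f : α → ℝ} {c : ℝ} (hf : ∀ a, |f a| ≤ c) : |∫ a, f a ∂ν| ≤ c := by
  simpa using norm_integral_le_of_norm_le_const (μ := ν) (f := f) (Eventually.of_forall hf)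

theorem abs_latentPropensity_le (a : ℤˣ) (c : 𝒰 × 𝒳) : |M.latentPropensity μ a c| ≤ 1 :=
  abs_integral_le_of_forall_abs_le fun _ => abs_treatInd_le a _

theorem propensityUX_ae_eq (a : ℤˣ) :
    M.propensityUX μ a =ᵐ[μ] fun ω => M.latentPropensity μ a (M.U ω, M.X ω) := by
  have hi : Integrable (fun ω => treatInd 𝒰 𝒳 𝒵 a ((M.U ω, M.X ω), (M.Z ω, M.A ω))) μ :=
    Integrable.of_bound ((measurable_treatInd a).comp
      (M.measurable_UX.prodMk M.measurable_ZA)).aestronglyMeasurable 1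
      (Eventually.of_forall fun ω => abs_treatInd_le a _)
  have := condExp_prod_ae_eq_integral_condDistrib M.measurable_UX M.measurable_ZA.aemeasurable
    (measurable_treatInd a).stronglyMeasurable hi
  refine EventuallyEq.trans (Eventually.of_forall fun ω => ?_) this
  refine congrFun (congrArg (fun f => μ[f | M.sigmaUX]) ?_) ω
  funext ω
  by_cases hA : M.A ω = a <;> simp [treatInd, Set.indicator, hA]

theorem latentPropensity_pos (hstd : M.StandardAssumptions μ) (a : ℤˣ) :
    ∀ᵐ ω ∂μ, 0 < M.latentPropensity μ a (M.U ω, M.X ω) := by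
  filter_upwards [propensityUX_ae_eq (M := M) (μ := μ) a, hstd.positivity a] with ω h1 h2
  rwa [← h1]

/-- The treatment may be replaced by the latent propensity score when multiplied by a function of
the potential outcome, the outcome proxy, and `(U, X)`. -/
theorem integral_treatInd_mul (hstd : M.StandardAssumptions μ) (a : ℤˣ)
    {ψ : (𝒰 × 𝒳) × ℝ × 𝒲 → ℝ} (hψ : Measurable ψ)
    (hint : Integrable (fun ω => ψ ((M.U ω, M.X ω), (M.Ya a ω, M.W ω))) μ) :
    ∫ ω, treatInd 𝒰 𝒳 𝒵 a ((M.U ω, M.X ω), (M.Z ω, M.A ω)) *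
        ψ ((M.U ω, M.X ω), (M.Ya a ω, M.W ω)) ∂μ =
      ∫ ω, M.latentPropensity μ a (M.U ω, M.X ω) * ψ ((M.U ω, M.X ω), (M.Ya a ω, M.W ω)) ∂μ := by
  refine integral_mul_eq_integral_condDistrib_mul M.measurable_ZA (M.measurable_YaW a)
    M.measurable_UX (hstd.unconfounded a) (measurable_treatInd a) hψ ?_ ?_
  · exact hint.bdd_mul (c := 1) ((measurable_treatInd a).comp
      (M.measurable_UX.prodMk M.measurable_ZA)).aestronglyMeasurable
      (Eventually.of_forall fun ω => abs_treatInd_le a _)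
  · exact hint.bdd_mul (c := 1) ((measurable_latentPropensity a).comp
      M.measurable_UX).aestronglyMeasurable
      (Eventually.of_forall fun ω => abs_latentPropensity_le a _)

/-- This is how positivity is used: weighting by an almost surely positive propensity cannot hide a
nonnegative function. Combined with `integral_treatInd_mul`, it carries null events from the treated
to the whole population. -/
theorem ae_eq_zero_of_integral_latentPropensity_mul (hstd : M.StandardAssumptions μ) (a : ℤˣ)
    {f : Ω → ℝ} (hf0 : ∀ ω, 0 ≤ f ω) (hf : Integrable f μ)
    (hle : ∫ ω, M.latentPropensity μ a (M.U ω, M.X ω) * f ω ∂μ ≤ 0) : ∀ᵐ ω ∂μ, f ω = 0 := by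
  have hpos := latentPropensity_pos hstd a
  have h0 : 0 ≤ᵐ[μ] fun ω => M.latentPropensity μ a (M.U ω, M.X ω) * f ω := by
    filter_upwards [hpos] with ω hω using mul_nonneg hω.le (hf0 ω)
  have hi : Integrable (fun ω => M.latentPropensity μ a (M.U ω, M.X ω) * f ω) μ :=
    hf.bdd_mul (c := 1) ((measurable_latentPropensity a).comp
      M.measurable_UX).aestronglyMeasurable
      (Eventually.of_forall fun ω => abs_latentPropensity_le a _)
  have := (integral_eq_zero_iff_of_nonneg_ae h0 hi).1 (le_antisymm hle (integral_nonneg_of_ae h0))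
  filter_upwards [this, hpos] with ω h1 h2
  exact (mul_eq_zero.1 h1).resolve_left h2.ne'

theorem Y_ae_eq_Ya (hstd : M.StandardAssumptions μ) (a : ℤˣ) :
    ∀ᵐ ω ∂μ, M.A ω = a → M.Y ω = M.Ya a ω := by
  filter_upwards [hstd.consistency_Y] with ω hω ha
  rw [hω, ha]; rfl

/-- A bound for the observed outcome holds for the potential outcomes. -/
theorem abs_Ya_le (hstd : M.StandardAssumptions μ) (hY : ∀ᵐ ω ∂μ, |M.Y ω| ≤ B) (a : ℤˣ) :
    ∀ᵐ ω ∂μ, |M.Ya a ω| ≤ B := by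
  -- The indicator of `|Y(a)| > B`. It vanishes almost surely on `{A = a}`, where `Y(a)` is the
  -- observed outcome, and positivity removes the restriction.
  let ψ : (𝒰 × 𝒳) × ℝ × 𝒲 → ℝ := fun p => if |p.2.1| ≤ B then 0 else 1
  have hψ : Measurable ψ := by
    refine Measurable.ite (measurableSet_le ?_ measurable_const) measurable_const measurable_const
    exact measurable_fst.comp measurable_snd |>.abs
  have hi : Integrable (fun ω => ψ ((M.U ω, M.X ω), (M.Ya a ω, M.W ω))) μ :=
    Integrable.of_bound (hψ.comp (M.measurable_UX.prodMk (M.measurable_YaW a))).aestronglyMeasurable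
      1 (Eventually.of_forall fun ω => by simp only [ψ]; split_ifs <;> simp)
  have hz := ae_eq_zero_of_integral_latentPropensity_mul hstd a
    (fun ω => by simp only [ψ]; split_ifs <;> simp) hi (by
      rw [← integral_treatInd_mul hstd a hψ hi]
      refine (integral_eq_zero_of_ae ?_).le
      filter_upwards [Y_ae_eq_Ya hstd a, hY] with ω h1 h2
      by_cases hA : M.A ω = a
      · simp [ψ, ← h1 hA, h2]
      · simp [treatInd, hA])
  filter_upwards [hz] with ω hω
  by_contra hcon
  simp [ψ, hcon] at hω

end Identification

end ProximalModel

/-! ### The two bridges at the latent level. -/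

namespace ProximalModel

section Bridges

variable {Ω 𝒰 𝒳 𝒲 𝒵 : Type*} [MeasurableSpace Ω] [StandardBorelSpace Ω] [MeasurableSpace 𝒰]
  [StandardBorelSpace 𝒰] [Nonempty 𝒰]
  [MeasurableSpace 𝒳] [MeasurableSpace 𝒲] [MeasurableSpace 𝒵]
  [StandardBorelSpace 𝒲] [StandardBorelSpace 𝒵] [Nonempty 𝒲] [Nonempty 𝒵]
  {M : ProximalModel Ω 𝒰 𝒳 𝒲 𝒵} {μ : Measure Ω} [IsProbabilityMeasure μ]
  {h : 𝒲 × ℤˣ × 𝒳 → ℝ} {q : 𝒵 × ℤˣ × 𝒳 → ℝ} {B : ℝ}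

/-- The truncated outcome minus the outcome bridge, as a function of `((u, x), (y, w))`. -/
def bridgeGap (𝒰 : Type*) {𝒳 𝒲 : Type*} (h : 𝒲 × ℤˣ × 𝒳 → ℝ) (B : ℝ) (a : ℤˣ)
    (p : (𝒰 × 𝒳) × ℝ × 𝒲) : ℝ :=
  max (-B) (min B p.2.1) - h (p.2.2, a, p.1.2)

theorem measurable_bridgeGap (hm : Measurable h) (a : ℤˣ) : Measurable (bridgeGap 𝒰 h B a) := by
  unfold bridgeGap
  fun_prop

theorem abs_bridgeGap_le (hh : ∀ v, |h v| ≤ B) (a : ℤˣ) (p : (𝒰 × 𝒳) × ℝ × 𝒲) :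
    |bridgeGap 𝒰 h B a p| ≤ 2 * B := by
  have h1 := abs_le.1 (hh (p.2.2, a, p.1.2))
  have h2 : -B ≤ B := by linarith [h1.1, h1.2]
  have h3 : -B ≤ max (-B) (min B p.2.1) := le_max_left _ _
  have h4 : max (-B) (min B p.2.1) ≤ B := max_le h2 (min_le_left _ _)
  unfold bridgeGap
  rw [abs_le]
  constructor <;> linarith [h1.1, h1.2]

theorem integrable_of_abs_le {f : Ω → ℝ} {c : ℝ} (hf : Measurable f) (hc : ∀ ω, |f ω| ≤ c) :
    Integrable f μ :=
  Integrable.of_bound hf.aestronglyMeasurable c (Eventually.of_forall hc)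

/-- The potential outcome may be replaced by the outcome bridge when multiplied by a function of
the covariates and the treatment proxy. -/
theorem integral_mul_Ya (hstd : M.StandardAssumptions μ)
    (hcompZ : ProxyComplete μ M.U M.Z M.A M.X) (hbridge : M.IsOutcomeBridge μ h)
    (hY : ∀ᵐ ω ∂μ, |M.Y ω| ≤ B) (hh : ∀ v, |h v| ≤ B) (a : ℤˣ) {s : 𝒳 × 𝒵 → ℝ}
    (hs : Measurable s) (hs1 : ∀ v, |s v| ≤ 1) :
    ∫ ω, s (M.X ω, M.Z ω) * M.Ya a ω ∂μ =
      ∫ ω, s (M.X ω, M.Z ω) * h (M.W ω, a, M.X ω) ∂μ := by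
  obtain ⟨hm, hb⟩ := hbridge
  have mX := M.measurable_X
  have mZ := M.measurable_Z
  have mA := M.measurable_A
  have mW := M.measurable_W
  have mY := M.measurable_Y
  have hψ := measurable_bridgeGap (𝒰 := 𝒰) (B := B) hm a
  have hψm : Measurable fun ω => bridgeGap 𝒰 h B a ((M.U ω, M.X ω), (M.Ya a ω, M.W ω)) :=
    hψ.comp (M.measurable_UX.prodMk (M.measurable_YaW a))
  -- The conditional mean of `Y(a) - h(W, a, X)` given `(U, X)`. The proof shows that it vanishes
  -- almost surely.
  let r : 𝒰 × 𝒳 → ℝ := fun c => ∫ b, bridgeGap 𝒰 h B a (c, b)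
    ∂(condDistrib (fun ω => (M.Ya a ω, M.W ω)) (fun ω => (M.U ω, M.X ω)) μ c)
  have hr : Measurable r :=
    (StronglyMeasurable.integral_condDistrib hψ.stronglyMeasurable).measurable
  have hr2 : ∀ c, |r c| ≤ 2 * B := fun c =>
    abs_integral_le_of_forall_abs_le fun _ => abs_bridgeGap_le hh a _
  have hB0 : 0 ≤ 2 * B := by
    obtain ⟨ω⟩ := μ.nonempty_of_neZero
    exact (abs_nonneg _).trans (hr2 (M.U ω, M.X ω))
  have hrm : Measurable fun ω => r (M.U ω, M.X ω) := hr.comp M.measurable_UX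
  have hswap : ∀ φ : (𝒰 × 𝒳) × 𝒵 × ℤˣ → ℝ, Measurable φ → (∀ p, |φ p| ≤ 1) →
      ∫ ω, φ ((M.U ω, M.X ω), (M.Z ω, M.A ω)) *
          bridgeGap 𝒰 h B a ((M.U ω, M.X ω), (M.Ya a ω, M.W ω)) ∂μ =
        ∫ ω, φ ((M.U ω, M.X ω), (M.Z ω, M.A ω)) * r (M.U ω, M.X ω) ∂μ := by
    intro φ hφ hφ1
    have hφm : Measurable fun ω => φ ((M.U ω, M.X ω), (M.Z ω, M.A ω)) :=
      hφ.comp (M.measurable_UX.prodMk M.measurable_ZA)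
    refine integral_mul_eq_integral_mul_condDistrib M.measurable_ZA (M.measurable_YaW a)
      M.measurable_UX (hstd.unconfounded a) hφ hψ ?_ ?_
    · exact (integrable_of_abs_le hψm fun ω => abs_bridgeGap_le hh a _).bdd_mul
        hφm.aestronglyMeasurable (Eventually.of_forall fun ω => hφ1 _)
    · exact (integrable_of_abs_le hrm fun ω => hr2 _).bdd_mul
        hφm.aestronglyMeasurable (Eventually.of_forall fun ω => hφ1 _)
  -- The truncation in `bridgeGap` keeps the integrand bounded everywhere, so that `r` is bounded
  -- for every `c`. Almost surely it changes nothing.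
  have hclamp : ∀ᵐ ω ∂μ, bridgeGap 𝒰 h B a ((M.U ω, M.X ω), (M.Ya a ω, M.W ω)) =
      M.Ya a ω - h (M.W ω, a, M.X ω) := by
    filter_upwards [abs_Ya_le hstd hY a] with ω hω
    have := abs_le.1 hω
    simp [bridgeGap, this.1, this.2]
  have hzero : ∀ᵐ ω ∂μ, r (M.U ω, M.X ω) = 0 := by
    refine hcompZ.ae_eq_zero M.measurable_U mZ mA mX hr
      (MemLp.of_bound hrm.aestronglyMeasurable (2 * B) (Eventually.of_forall fun ω => hr2 _)) a ?_
    intro D hD C hC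
    classical
    let T : Set ((𝒰 × 𝒳) × 𝒵 × ℤˣ) := {p | p.1.2 ∈ D ∧ p.2.1 ∈ C ∧ p.2.2 = a}
    have hT : MeasurableSet T :=
      ((measurable_snd.comp measurable_fst) hD).inter
        (((measurable_fst.comp measurable_snd) hC).inter
          ((measurable_snd.comp measurable_snd) (measurableSet_singleton a)))
    have hS' : MeasurableSet[M.sigmaZAX] {ω | M.X ω ∈ D ∧ M.Z ω ∈ C ∧ M.A ω = a} :=
      ⟨{p | p.2.2 ∈ D ∧ p.1 ∈ C ∧ p.2.1 = a},
        ((measurable_snd.comp measurable_snd) hD).inter ((measurable_fst hC).inter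
          ((measurable_fst.comp measurable_snd) (measurableSet_singleton a))), rfl⟩
    have hle : M.sigmaZAX ≤ ‹MeasurableSpace Ω› := (mZ.prodMk (mA.prodMk mX)).comap_le
    have hS := hle _ hS'
    have h1 := hswap (T.indicator 1) (measurable_one.indicator hT) (fun p => by
      by_cases hp : p ∈ T <;> simp [hp])
    have hYi : Integrable M.Y μ := Integrable.of_bound mY.aestronglyMeasurable B hY
    have hhi : Integrable (fun ω => h (M.W ω, M.A ω, M.X ω)) μ :=
      integrable_of_abs_le (by fun_prop) fun ω => hh _
    -- The outcome bridge tested on an event of `(Z, A, X)`. On that event `A = a`, so its integrand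
    -- is the bridge gap, and `hswap` replaces the gap by `r`.
    have h2 : ∫ ω in {ω | M.X ω ∈ D ∧ M.Z ω ∈ C ∧ M.A ω = a},
        (M.Y ω - h (M.W ω, M.A ω, M.X ω)) ∂μ = 0 := by
      rw [integral_sub hYi.restrict hhi.restrict, ← setIntegral_condExp hle hYi hS',
        ← setIntegral_condExp hle hhi hS', sub_eq_zero]
      exact setIntegral_congr_ae hS (hb.mono fun ω hω _ => hω)
    rw [← integral_indicator hS] at h2 ⊢
    refine Eq.trans ?_ (h1.symm.trans (Eq.trans ?_ h2))
    · refine integral_congr_ae (Eventually.of_forall fun ω => ?_)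
      by_cases hω : M.X ω ∈ D ∧ M.Z ω ∈ C ∧ M.A ω = a <;> simp [T, Set.indicator, hω]
    · refine integral_congr_ae ?_
      filter_upwards [hclamp, Y_ae_eq_Ya hstd a] with ω h3 h4
      by_cases hω : M.X ω ∈ D ∧ M.Z ω ∈ C ∧ M.A ω = a
      · simp [T, Set.indicator, hω, h3, h4 hω.2.2]
      · simp [T, Set.indicator, hω]
  -- The same exchange, now without restricting to `A = a`. The right-hand side is zero because `r`
  -- is.
  have h1 := hswap (fun p => s (p.1.2, p.2.1)) (by fun_prop) (fun p => hs1 _)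
  have hsm : Measurable fun ω => s (M.X ω, M.Z ω) := by fun_prop
  have hYa : Integrable (fun ω => M.Ya a ω) μ :=
    Integrable.of_bound (M.measurable_Ya a).aestronglyMeasurable B (abs_Ya_le hstd hY a)
  have hhi : Integrable (fun ω => h (M.W ω, a, M.X ω)) μ :=
    integrable_of_abs_le (by fun_prop) fun ω => hh _
  rw [← sub_eq_zero, ← integral_sub
    (hYa.bdd_mul hsm.aestronglyMeasurable (Eventually.of_forall fun ω => hs1 _))
    (hhi.bdd_mul hsm.aestronglyMeasurable (Eventually.of_forall fun ω => hs1 _))]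
  refine Eq.trans (integral_congr_ae ?_) (h1.trans (integral_eq_zero_of_ae ?_))
  · filter_upwards [hclamp] with ω hω
    simp only [hω, mul_sub]
  · filter_upwards [hzero] with ω hω
    simp [hω]

/-- On the event where this score is at most zero, the treated mass is the integral of the score,
hence not positive. Latent positivity then makes the event null. -/
theorem propensityWX_pos (hstd : M.StandardAssumptions μ) (a : ℤˣ) :
    ∀ᵐ ω ∂μ, 0 < M.propensityWX μ a ω := by
  have hle : M.sigmaWX ≤ ‹MeasurableSpace Ω› :=
    (M.measurable_W.prodMk M.measurable_X).comap_le
  have hN' : MeasurableSet[M.sigmaWX] {ω | M.propensityWX μ a ω ≤ 0} := by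
    have hpm : Measurable[M.sigmaWX] (M.propensityWX μ a) := stronglyMeasurable_condExp.measurable
    exact hpm measurableSet_Iic
  have hN := hle _ hN'
  have hAi : Integrable ((M.A ⁻¹' {a}).indicator fun _ => (1 : ℝ)) μ :=
    (integrable_const 1).indicator (M.measurable_A (measurableSet_singleton a))
  have h1 := setIntegral_condExp hle hAi hN'
  obtain ⟨T, hT, hTN⟩ := hN'
  let ψ : (𝒰 × 𝒳) × ℝ × 𝒲 → ℝ := fun p => T.indicator 1 (p.2.2, p.1.2)
  have hψ : Measurable ψ := (measurable_one.indicator hT).comp (by fun_prop)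
  have hi : Integrable (fun ω => ψ ((M.U ω, M.X ω), (M.Ya a ω, M.W ω))) μ := by
    refine integrable_of_abs_le (c := 1)
      (hψ.comp (M.measurable_UX.prodMk (M.measurable_YaW a))) fun ω => ?_
    by_cases hω : (M.W ω, M.X ω) ∈ T <;> simp [ψ, hω]
  have h2 := integral_treatInd_mul hstd a hψ hi
  have hz := ae_eq_zero_of_integral_latentPropensity_mul hstd a
    (fun ω => by by_cases hω : (M.W ω, M.X ω) ∈ T <;> simp [ψ, hω]) hi (by
      rw [← h2]
      refine le_trans (le_of_eq ?_) (h1.symm.le.trans (setIntegral_nonpos hN fun ω hω => hω))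
      rw [← integral_indicator hN, ← hTN]
      refine integral_congr_ae (Eventually.of_forall fun ω => ?_)
      by_cases hω : (M.W ω, M.X ω) ∈ T <;> by_cases hA : M.A ω = a <;>
        simp [ψ, treatInd, Set.indicator, hω, hA])
  filter_upwards [hz] with ω hω
  by_contra hcon
  have : ω ∈ (fun ω => (M.W ω, M.X ω)) ⁻¹' T := by rw [hTN]; exact not_lt.1 hcon
  have : (M.W ω, M.X ω) ∈ T := this
  simp [ψ, this] at hω

/-- Otherwise the latent propensity, which is almost surely positive, would have mean zero. This
makes conditioning on `A = a` nondegenerate. -/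
theorem measure_treat_ne_zero (hstd : M.StandardAssumptions μ) (a : ℤˣ) :
    μ (M.A ⁻¹' {a}) ≠ 0 := by
  intro h0
  have hle : M.sigmaUX ≤ ‹MeasurableSpace Ω› := M.measurable_UX.comap_le
  have h1 : ∫ ω, M.propensityUX μ a ω ∂μ = 0 := by
    rw [propensityUX, integral_condExp hle,
      integral_indicator (M.measurable_A (measurableSet_singleton a)),
      Measure.restrict_eq_zero.2 h0, integral_zero_measure]
  have h2 := (integral_eq_zero_iff_of_nonneg_ae
    ((hstd.positivity a).mono fun ω hω => hω.le) integrable_condExp).1 h1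
  have : ∀ᵐ ω ∂μ, False := by
    filter_upwards [h2, hstd.positivity a] with ω h3 h4
    exact h4.ne' h3
  exact (NeZero.ne μ) (ae_eq_bot.1 (eventually_false_iff_eq_bot.1 this))

theorem ae_of_ae_cond {s : Set Ω} (hs : MeasurableSet s) {p : Ω → Prop}
    (hp : ∀ᵐ ω ∂(μ[|s]), p ω) : ∀ᵐ ω ∂μ, ω ∈ s → p ω := by
  rw [ProbabilityTheory.cond,
    Measure.ae_ennreal_smul_measure_iff (ENNReal.inv_ne_zero.2 (measure_ne_top μ s))] at hp
  exact (ae_restrict_iff' hs).1 hp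

/-- The treatment bridge reweights the treated to the whole population, over events in `(W, X)`. -/
theorem setIntegral_treatmentBridge (hstd : M.StandardAssumptions μ)
    (qbridge : M.IsTreatmentBridge μ q) (hq : ∀ v, |q v| ≤ B) (a : ℤˣ) {S : Set Ω}
    (hS : MeasurableSet[M.sigmaWX] S) :
    ∫ ω in S ∩ M.A ⁻¹' {a}, q (M.Z ω, a, M.X ω) ∂μ = μ.real S := by
  obtain ⟨hm, hb⟩ := qbridge
  have mX := M.measurable_X
  have mZ := M.measurable_Z
  have hA : MeasurableSet (M.A ⁻¹' {a}) := M.measurable_A (measurableSet_singleton a)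
  have hle : M.sigmaWX ≤ ‹MeasurableSpace Ω› :=
    (M.measurable_W.prodMk M.measurable_X).comap_le
  have h0 := measure_treat_ne_zero hstd a
  have hc : ((μ (M.A ⁻¹' {a}))⁻¹).toReal ≠ 0 :=
    (ENNReal.toReal_ne_zero).2 ⟨ENNReal.inv_ne_zero.2 (measure_ne_top _ _), ENNReal.inv_ne_top.2 h0⟩
  have hqi : Integrable (fun ω => q (M.Z ω, a, M.X ω)) μ :=
    integrable_of_abs_le (by fun_prop) fun ω => hq _
  have hqi' := integrable_cond (M.A ⁻¹' {a}) hqi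
  have hpm : StronglyMeasurable[M.sigmaWX] (M.propensityWX μ a) := stronglyMeasurable_condExp
  have hpm' : StronglyMeasurable[M.sigmaWX] fun ω => 1 / M.propensityWX μ a ω := by
    simp only [one_div]
    exact hpm.measurable.inv.stronglyMeasurable
  -- The bridge equation holds under `P(· | A = a)`. Its normalizing constant is nonzero and
  -- cancels.
  have h1 : ∫ ω in S ∩ M.A ⁻¹' {a}, q (M.Z ω, a, M.X ω) ∂μ =
      ∫ ω in S ∩ M.A ⁻¹' {a}, 1 / M.propensityWX μ a ω ∂μ := by
    have := cond_isProbabilityMeasure h0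
    have h2 := setIntegral_condExp hle hqi' hS
    rw [setIntegral_congr_ae (hle _ hS) ((hb a).mono fun ω hω _ => hω.symm),
      setIntegral_cond _ (hle _ hS), setIntegral_cond _ (hle _ hS)] at h2
    exact (mul_left_cancel₀ hc h2).symm
  -- On the treated, the inverse propensity is a conditional mean of a function bounded by `B`. This
  -- gives the integrability needed to pull it out of a conditional expectation.
  have hbdd : ∀ᵐ ω ∂μ, ω ∈ M.A ⁻¹' {a} → |1 / M.propensityWX μ a ω| ≤ B := by
    refine ae_of_ae_cond hA ?_
    have := ae_bdd_abs_condExp_of_ae_bdd_abs (m := M.sigmaWX) (R := B) (μ := μ[|M.A ⁻¹' {a}])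
      (f := fun ω => q (M.Z ω, a, M.X ω)) (Eventually.of_forall fun ω => hq _)
    filter_upwards [hb a, this] with ω h2 h3
    rw [h2]
    exact h3
  have hAi : Integrable ((M.A ⁻¹' {a}).indicator fun _ => (1 : ℝ)) μ :=
    (integrable_const 1).indicator hA
  have hprod : Integrable ((M.A ⁻¹' {a}).indicator (fun _ => (1 : ℝ)) *
      fun ω => 1 / M.propensityWX μ a ω) μ := by
    refine Integrable.of_bound (hAi.aestronglyMeasurable.mul
      (hpm'.mono hle).aestronglyMeasurable) (max B 0) ?_
    filter_upwards [hbdd] with ω hω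
    by_cases hmem : ω ∈ M.A ⁻¹' {a}
    · simpa [hmem] using Or.inl (hω hmem)
    · simp [hmem]
  have h3 := condExp_mul_of_stronglyMeasurable_right hpm' hprod hAi
  calc ∫ ω in S ∩ M.A ⁻¹' {a}, q (M.Z ω, a, M.X ω) ∂μ
      = ∫ ω in S ∩ M.A ⁻¹' {a}, 1 / M.propensityWX μ a ω ∂μ := h1
    _ = ∫ ω in S, ((M.A ⁻¹' {a}).indicator (fun _ => (1 : ℝ)) *
          fun ω => 1 / M.propensityWX μ a ω) ω ∂μ := by
        rw [← setIntegral_indicator hA]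
        refine integral_congr_ae (Eventually.of_forall fun ω => ?_)
        by_cases hmem : ω ∈ M.A ⁻¹' {a} <;> simp [Set.indicator, hmem]
    _ = ∫ ω in S, (1 : ℝ) ∂μ := by
        rw [← setIntegral_condExp hle hprod hS]
        refine setIntegral_congr_ae (hle _ hS) ?_
        filter_upwards [h3, propensityWX_pos hstd a] with ω h4 h5 _
        rw [h4, Pi.mul_apply]
        exact mul_one_div_cancel h5.ne'
    _ = μ.real S := by simp

/-- The treatment bridge restricted to treatment `a`, as a function of `((u, x), (z, a'))`. -/
def weightedTreat (𝒰 : Type*) {𝒳 𝒵 : Type*} (q : 𝒵 × ℤˣ × 𝒳 → ℝ) (a : ℤˣ)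
    (p : (𝒰 × 𝒳) × 𝒵 × ℤˣ) : ℝ :=
  treatInd 𝒰 𝒳 𝒵 a p * q (p.2.1, a, p.1.2)

theorem measurable_weightedTreat (hm : Measurable q) (a : ℤˣ) :
    Measurable (weightedTreat 𝒰 q a) := by
  have := measurable_treatInd (𝒰 := 𝒰) (𝒳 := 𝒳) (𝒵 := 𝒵) a
  unfold weightedTreat
  fun_prop

theorem abs_weightedTreat_le (hq : ∀ v, |q v| ≤ B) (a : ℤˣ) (p : (𝒰 × 𝒳) × 𝒵 × ℤˣ) :
    |weightedTreat 𝒰 q a p| ≤ B := by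
  have h0 := (abs_nonneg _).trans (hq (p.2.1, a, p.1.2))
  rw [weightedTreat, abs_mul]
  calc _ ≤ 1 * B := mul_le_mul (abs_treatInd_le a p) (hq _) (abs_nonneg _) zero_le_one
    _ = B := one_mul B

/-- Weighting by the treatment bridge on `{A = a}` has no effect on the mean of a function of the
covariates and the outcome proxy times the potential outcome. -/
theorem integral_weightedTreat_mul_Ya (hstd : M.StandardAssumptions μ)
    (hcompW : ProxyComplete μ M.U M.W M.A M.X) (qbridge : M.IsTreatmentBridge μ q)
    (hY : ∀ᵐ ω ∂μ, |M.Y ω| ≤ B) (hq : ∀ v, |q v| ≤ B)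
    (hinv : ∀ a, Integrable (fun ω => (1 / M.propensityUX μ a ω) ^ 2) μ)
    (a : ℤˣ) {s : 𝒳 × 𝒲 → ℝ} (hs : Measurable s) (hs1 : ∀ v, |s v| ≤ 1) :
    ∫ ω, weightedTreat 𝒰 q a ((M.U ω, M.X ω), (M.Z ω, M.A ω)) * (s (M.X ω, M.W ω) * M.Ya a ω) ∂μ =
      ∫ ω, s (M.X ω, M.W ω) * M.Ya a ω ∂μ := by
  have hm := qbridge.1
  have mX := M.measurable_X
  have mA := M.measurable_A
  have mW := M.measurable_W
  have hφ := measurable_weightedTreat (𝒰 := 𝒰) hm a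
  have hφm : Measurable fun ω => weightedTreat 𝒰 q a ((M.U ω, M.X ω), (M.Z ω, M.A ω)) :=
    hφ.comp (M.measurable_UX.prodMk M.measurable_ZA)
  let t : 𝒰 × 𝒳 → ℝ := fun c => ∫ b, weightedTreat 𝒰 q a (c, b)
    ∂(condDistrib (fun ω => (M.Z ω, M.A ω)) (fun ω => (M.U ω, M.X ω)) μ c)
  have ht : Measurable t :=
    (StronglyMeasurable.integral_condDistrib hφ.stronglyMeasurable).measurable
  have htB : ∀ c, |t c| ≤ B := fun c =>
    abs_integral_le_of_forall_abs_le fun _ => abs_weightedTreat_le hq a _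
  have htm : Measurable fun ω => t (M.U ω, M.X ω) := ht.comp M.measurable_UX
  have hswap : ∀ ψ : (𝒰 × 𝒳) × ℝ × 𝒲 → ℝ, Measurable ψ →
      Integrable (fun ω => ψ ((M.U ω, M.X ω), (M.Ya a ω, M.W ω))) μ →
      ∫ ω, weightedTreat 𝒰 q a ((M.U ω, M.X ω), (M.Z ω, M.A ω)) *
          ψ ((M.U ω, M.X ω), (M.Ya a ω, M.W ω)) ∂μ =
        ∫ ω, t (M.U ω, M.X ω) * ψ ((M.U ω, M.X ω), (M.Ya a ω, M.W ω)) ∂μ := by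
    intro ψ hψ hψi
    refine integral_mul_eq_integral_condDistrib_mul M.measurable_ZA (M.measurable_YaW a)
      M.measurable_UX (hstd.unconfounded a) hφ hψ ?_ ?_
    · exact hψi.bdd_mul hφm.aestronglyMeasurable
        (Eventually.of_forall fun ω => abs_weightedTreat_le hq a _)
    · exact hψi.bdd_mul htm.aestronglyMeasurable (Eventually.of_forall fun ω => htB _)
  let e := M.latentPropensity μ a
  have he : Measurable e := measurable_latentPropensity a
  have hem : Measurable fun ω => e (M.U ω, M.X ω) := he.comp M.measurable_UX
  have hepos : ∀ᵐ ω ∂μ, 0 < e (M.U ω, M.X ω) := latentPropensity_pos hstd a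
  -- Here `t` is the conditional mean of `1{A = a} q` given `(U, X)`, and the aim is `t = 1`.
  -- Completeness tests integrals over treated units, which introduces a factor `e`, so `t - 1` is
  -- divided by `e` beforehand. The second moment of the inverse propensity makes `g`
  -- square-integrable.
  let g : 𝒰 × 𝒳 → ℝ := fun c => (t c - 1) * (e c)⁻¹
  have hg : Measurable g := by fun_prop
  have hgm : Measurable fun ω => g (M.U ω, M.X ω) := hg.comp M.measurable_UX
  have hem' : Measurable fun ω => (e (M.U ω, M.X ω))⁻¹ := hem.inv
  have hinvL : MemLp (fun ω => (e (M.U ω, M.X ω))⁻¹) 2 μ := by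
    refine (memLp_two_iff_integrable_sq hem'.aestronglyMeasurable).2 ((hinv a).congr ?_)
    filter_upwards [propensityUX_ae_eq (M := M) (μ := μ) a] with ω hω
    rw [hω, one_div]
  have hgL : MemLp (fun ω => g (M.U ω, M.X ω)) 2 μ := by
    refine hinvL.of_le_mul (c := B + 1) hgm.aestronglyMeasurable (Eventually.of_forall fun ω => ?_)
    rw [norm_mul]
    refine mul_le_mul_of_nonneg_right ((norm_sub_le _ _).trans ?_) (norm_nonneg _)
    simpa using htB _
  have hgz : ∀ᵐ ω ∂μ, g (M.U ω, M.X ω) = 0 := by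
    refine hcompW.ae_eq_zero M.measurable_U mW mA mX hg hgL a ?_
    intro D hD C hC
    have hS' : MeasurableSet[M.sigmaWX] {ω | M.X ω ∈ D ∧ M.W ω ∈ C} :=
      ⟨{p | p.2 ∈ D ∧ p.1 ∈ C}, (measurable_snd hD).inter (measurable_fst hC), rfl⟩
    have hle : M.sigmaWX ≤ ‹MeasurableSpace Ω› := (mW.prodMk mX).comap_le
    have hS := hle _ hS'
    let T : Set ((𝒰 × 𝒳) × ℝ × 𝒲) := {p | p.1.2 ∈ D ∧ p.2.2 ∈ C}
    have hT : MeasurableSet T := ((measurable_snd.comp measurable_fst) hD).inter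
      ((measurable_snd.comp measurable_snd) hC)
    have hTi : ∀ f : Ω → ℝ, Integrable f μ →
        Integrable (fun ω => T.indicator 1 ((M.U ω, M.X ω), (M.Ya a ω, M.W ω)) * f ω) μ := by
      intro f hf
      refine hf.bdd_mul (c := 1) ((measurable_one.indicator hT).comp
        (M.measurable_UX.prodMk (M.measurable_YaW a))).aestronglyMeasurable
        (Eventually.of_forall fun ω => ?_)
      by_cases hω : M.X ω ∈ D ∧ M.W ω ∈ C <;> simp [T, Set.indicator, hω]
    have hTi1 := hTi 1 (integrable_const 1)
    simp only [Pi.one_apply, mul_one] at hTi1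
    have h1 := setIntegral_treatmentBridge hstd qbridge hq a hS'
    have h2 := hswap (T.indicator 1) (measurable_one.indicator hT) hTi1
    have h3 := integral_treatInd_mul hstd a (ψ := fun p => T.indicator 1 p * g p.1)
      ((measurable_one.indicator hT).mul (hg.comp measurable_fst))
      (hTi _ (hgL.integrable (by norm_num)))
    have hset : MeasurableSet {ω | M.X ω ∈ D ∧ M.W ω ∈ C ∧ M.A ω = a} :=
      (mX hD).inter ((mW hC).inter (mA (measurableSet_singleton a)))
    -- Integrating over `A = a` produces the factor `e`, and `e * g = t - 1`. The treatment bridge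
    -- then equates the two remaining terms.
    have h4 : ∫ ω in {ω | M.X ω ∈ D ∧ M.W ω ∈ C ∧ M.A ω = a}, g (M.U ω, M.X ω) ∂μ =
        ∫ ω, (t (M.U ω, M.X ω) * T.indicator 1 ((M.U ω, M.X ω), (M.Ya a ω, M.W ω)) -
          T.indicator 1 ((M.U ω, M.X ω), (M.Ya a ω, M.W ω))) ∂μ := by
      rw [← integral_indicator hset]
      refine Eq.trans (integral_congr_ae (Eventually.of_forall fun ω => ?_))
        (h3.trans (integral_congr_ae ?_))
      · by_cases h5 : M.X ω ∈ D ∧ M.W ω ∈ C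
        · by_cases h6 : M.A ω = a <;> simp [T, treatInd, Set.indicator, h5, h6]
        · have : ¬ (M.X ω ∈ D ∧ M.W ω ∈ C ∧ M.A ω = a) := fun h => h5 ⟨h.1, h.2.1⟩
          simp [T, Set.indicator, h5, this]
      · filter_upwards [hepos] with ω hω
        have : e (M.U ω, M.X ω) * g (M.U ω, M.X ω) = t (M.U ω, M.X ω) - 1 := by
          simp only [g]; field_simp
        calc _ = T.indicator 1 ((M.U ω, M.X ω), (M.Ya a ω, M.W ω)) *
              (e (M.U ω, M.X ω) * g (M.U ω, M.X ω)) := by simp only [e]; ring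
          _ = _ := by rw [this]; ring
    have h7 : Integrable (fun ω => t (M.U ω, M.X ω) *
        T.indicator 1 ((M.U ω, M.X ω), (M.Ya a ω, M.W ω))) μ :=
      hTi1.bdd_mul htm.aestronglyMeasurable (Eventually.of_forall fun ω => htB _)
    rw [h4, integral_sub h7 hTi1, ← h2, sub_eq_zero]
    have h8 : ∫ ω, T.indicator (1 : (𝒰 × 𝒳) × ℝ × 𝒲 → ℝ) ((M.U ω, M.X ω), (M.Ya a ω, M.W ω)) ∂μ =
        μ.real {ω | M.X ω ∈ D ∧ M.W ω ∈ C} := by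
      rw [← integral_indicator_one hS]
      rfl
    rw [h8, ← h1, ← integral_indicator (hS.inter (mA (measurableSet_singleton a)))]
    refine integral_congr_ae (Eventually.of_forall fun ω => ?_)
    by_cases h5 : M.X ω ∈ D ∧ M.W ω ∈ C <;> by_cases h6 : M.A ω = a <;>
      simp [T, weightedTreat, treatInd, Set.indicator, h5, h6]
  have hYa : Integrable (fun ω => M.Ya a ω) μ :=
    Integrable.of_bound (M.measurable_Ya a).aestronglyMeasurable B (abs_Ya_le hstd hY a)
  have hfin := hswap (fun p => s (p.1.2, p.2.2) * p.2.1) (by fun_prop)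
    (hYa.bdd_mul (Measurable.aestronglyMeasurable (by fun_prop))
      (Eventually.of_forall fun ω => hs1 _))
  refine hfin.trans (integral_congr_ae ?_)
  filter_upwards [hgz, hepos] with ω h1 h2
  have : t (M.U ω, M.X ω) = 1 := by
    have := (mul_eq_zero.1 h1).resolve_right (inv_ne_zero h2.ne')
    linarith
  simp [this]

end Bridges

end ProximalModel

/-! ### Conditional means given `X` and identification of the value. -/

namespace ProximalModel

section Value

variable {Ω 𝒰 𝒳 𝒲 𝒵 : Type*} [MeasurableSpace Ω] [StandardBorelSpace Ω] [MeasurableSpace 𝒰]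
  [StandardBorelSpace 𝒰] [Nonempty 𝒰]
  [MeasurableSpace 𝒳] [MeasurableSpace 𝒲] [MeasurableSpace 𝒵]
  [StandardBorelSpace 𝒲] [StandardBorelSpace 𝒵] [Nonempty 𝒲] [Nonempty 𝒵]
  {M : ProximalModel Ω 𝒰 𝒳 𝒲 𝒵} {μ : Measure Ω} [IsProbabilityMeasure μ]
  {h : 𝒲 × ℤˣ × 𝒳 → ℝ} {q : 𝒵 × ℤˣ × 𝒳 → ℝ} {B : ℝ} {Ξ : Type*} [MeasurableSpace Ξ]

instance : IsMarkovKernel (M.condLaw μ) := by unfold condLaw; infer_instance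

theorem measurable_obs (M : ProximalModel Ω 𝒰 𝒳 𝒲 𝒵) :
    Measurable fun ω => (M.W ω, M.Z ω, M.A ω, M.Y ω) :=
  M.measurable_W.prodMk (M.measurable_Z.prodMk (M.measurable_A.prodMk M.measurable_Y))

theorem compProd_condLaw : (μ.map M.X) ⊗ₘ (M.condLaw μ) =
    μ.map fun ω => (M.X ω, M.W ω, M.Z ω, M.A ω, M.Y ω) :=
  compProd_map_condDistrib M.measurable_obs.aemeasurable

theorem measurable_X_obs (M : ProximalModel Ω 𝒰 𝒳 𝒲 𝒵) :
    Measurable fun ω => (M.X ω, M.W ω, M.Z ω, M.A ω, M.Y ω) :=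
  M.measurable_X.prodMk M.measurable_obs

theorem integral_condLaw {F : 𝒳 × 𝒲 × 𝒵 × ℤˣ × ℝ → ℝ} (hF : Measurable F)
    (hi : Integrable (fun ω => F (M.X ω, M.W ω, M.Z ω, M.A ω, M.Y ω)) μ) :
    ∫ ω, F (M.X ω, M.W ω, M.Z ω, M.A ω, M.Y ω) ∂μ =
      ∫ x, ∫ o, F (x, o) ∂(M.condLaw μ x) ∂(μ.map M.X) := by
  rw [← Measure.integral_compProd, compProd_condLaw,
    integral_map M.measurable_X_obs.aemeasurable hF.aestronglyMeasurable]
  rw [compProd_condLaw]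
  exact (integrable_map_measure hF.aestronglyMeasurable M.measurable_X_obs.aemeasurable).2 hi

/-- The integrand of `meanZ`. -/
def outcomeTerm {𝒳 𝒲 𝒵 : Type*} (h : 𝒲 × ℤˣ × 𝒳 → ℝ) (dz : 𝒳 × 𝒵 → ℤˣ) (x : 𝒳)
    (o : 𝒲 × 𝒵 × ℤˣ × ℝ) : ℝ :=
  h (o.1, dz (x, o.2.1), x)

/-- The integrand of `meanW`. -/
def treatmentTerm {𝒳 𝒲 𝒵 : Type*} (q : 𝒵 × ℤˣ × 𝒳 → ℝ) (dw : 𝒳 × 𝒲 → ℤˣ) (x : 𝒳)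
    (o : 𝒲 × 𝒵 × ℤˣ × ℝ) : ℝ :=
  o.2.2.2 * q (o.2.1, o.2.2.1, x) * (if dw (x, o.1) = o.2.2.1 then 1 else 0)

theorem measurable_outcomeTerm (hm : Measurable h) {dz : Ξ × (𝒳 × 𝒵) → ℤˣ} (hdz : Measurable dz) :
    Measurable fun p : (Ξ × 𝒳) × (𝒲 × 𝒵 × ℤˣ × ℝ) =>
      outcomeTerm h (fun v => dz (p.1.1, v)) p.1.2 p.2 := by
  unfold outcomeTerm
  fun_prop

theorem measurable_treatmentTerm (hm : Measurable q) {dw : Ξ × (𝒳 × 𝒲) → ℤˣ}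
    (hdw : Measurable dw) :
    Measurable fun p : (Ξ × 𝒳) × (𝒲 × 𝒵 × ℤˣ × ℝ) =>
      treatmentTerm q (fun v => dw (p.1.1, v)) p.1.2 p.2 := by
  unfold treatmentTerm
  refine Measurable.mul (by fun_prop) (Measurable.ite ?_ measurable_const measurable_const)
  exact measurableSet_eq_fun (by fun_prop) (by fun_prop)

theorem measurable_outcomeTerm' (hm : Measurable h) {dz : 𝒳 × 𝒵 → ℤˣ} (hdz : Measurable dz) :
    Measurable fun p : 𝒳 × (𝒲 × 𝒵 × ℤˣ × ℝ) => outcomeTerm h dz p.1 p.2 := by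
  unfold outcomeTerm
  fun_prop

theorem measurable_treatmentTerm' (hm : Measurable q) {dw : 𝒳 × 𝒲 → ℤˣ} (hdw : Measurable dw) :
    Measurable fun p : 𝒳 × (𝒲 × 𝒵 × ℤˣ × ℝ) => treatmentTerm q dw p.1 p.2 := by
  unfold treatmentTerm
  refine Measurable.mul (by fun_prop) (Measurable.ite ?_ measurable_const measurable_const)
  exact measurableSet_eq_fun (by fun_prop) (by fun_prop)

theorem abs_treatmentTerm_le (hq : ∀ v, |q v| ≤ B) (dw : 𝒳 × 𝒲 → ℤˣ) (x : 𝒳)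
    {o : 𝒲 × 𝒵 × ℤˣ × ℝ} (ho : |o.2.2.2| ≤ B) : |treatmentTerm q dw x o| ≤ B * B := by
  have hB : 0 ≤ B := (abs_nonneg _).trans ho
  unfold treatmentTerm
  split_ifs
  · rw [mul_one, abs_mul]
    exact mul_le_mul ho (hq _) (abs_nonneg _) hB
  · simpa using mul_nonneg hB hB

theorem ae_condLaw_abs_le (hY : ∀ᵐ ω ∂μ, |M.Y ω| ≤ B) :
    ∀ᵐ x ∂(μ.map M.X), ∀ᵐ o ∂(M.condLaw μ x), |o.2.2.2| ≤ B := by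
  refine Measure.ae_ae_of_ae_compProd
    (p := fun p : 𝒳 × 𝒲 × 𝒵 × ℤˣ × ℝ => |p.2.2.2.2| ≤ B) ?_
  rw [compProd_condLaw]
  refine (ae_map_iff M.measurable_X_obs.aemeasurable ?_).2 hY
  exact measurableSet_le (by fun_prop) measurable_const

/-- Measurability is joint in the training data and `x`, as Tonelli's theorem requires later. It is
obtained by viewing `condLaw` as a kernel that ignores the training data. -/
theorem measurable_meanZ (hm : Measurable h) {dz : Ξ → 𝒳 × 𝒵 → ℤˣ}
    (hdz : Measurable fun s : Ξ × (𝒳 × 𝒵) => dz s.1 s.2) :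
    Measurable fun p : Ξ × 𝒳 => M.meanZ μ h (dz p.1) p.2 :=
  (StronglyMeasurable.integral_kernel_prod_right' (κ := (M.condLaw μ).prodMkLeft Ξ)
    (measurable_outcomeTerm hm hdz).stronglyMeasurable).measurable

theorem measurable_meanW (hm : Measurable q) {dw : Ξ → 𝒳 × 𝒲 → ℤˣ}
    (hdw : Measurable fun s : Ξ × (𝒳 × 𝒲) => dw s.1 s.2) :
    Measurable fun p : Ξ × 𝒳 => M.meanW μ q (dw p.1) p.2 :=
  (StronglyMeasurable.integral_kernel_prod_right' (κ := (M.condLaw μ).prodMkLeft Ξ)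
    (measurable_treatmentTerm hm hdw).stronglyMeasurable).measurable

theorem measurable_meanZ' (hm : Measurable h) {dz : 𝒳 × 𝒵 → ℤˣ} (hdz : Measurable dz) :
    Measurable (M.meanZ μ h dz) :=
  (StronglyMeasurable.integral_kernel_prod_right' (κ := M.condLaw μ)
    (measurable_outcomeTerm' hm hdz).stronglyMeasurable).measurable

theorem measurable_meanW' (hm : Measurable q) {dw : 𝒳 × 𝒲 → ℤˣ} (hdw : Measurable dw) :
    Measurable (M.meanW μ q dw) :=
  (StronglyMeasurable.integral_kernel_prod_right' (κ := M.condLaw μ)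
    (measurable_treatmentTerm' hm hdw).stronglyMeasurable).measurable

theorem abs_meanZ_le (hh : ∀ v, |h v| ≤ B) (dz : 𝒳 × 𝒵 → ℤˣ) (x : 𝒳) :
    |M.meanZ μ h dz x| ≤ B :=
  abs_integral_le_of_forall_abs_le fun _ => hh _

/-- The null set comes only from the bound on `Y`, so it can be chosen before the regime. One null
set therefore serves all realizations of the training data. -/
theorem abs_meanW_le (hY : ∀ᵐ ω ∂μ, |M.Y ω| ≤ B) (hq : ∀ v, |q v| ≤ B) :
    ∀ᵐ x ∂(μ.map M.X), ∀ dw : 𝒳 × 𝒲 → ℤˣ, |M.meanW μ q dw x| ≤ B * B := by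
  filter_upwards [ae_condLaw_abs_le hY] with x hx dw
  have := norm_integral_le_of_norm_le_const (μ := M.condLaw μ x) (f := treatmentTerm q dw x)
    (hx.mono fun o ho => abs_treatmentTerm_le hq dw x ho)
  simpa using! this

theorem delta_eq_sub (hmh : Measurable h) (hmq : Measurable q) (hY : ∀ᵐ ω ∂μ, |M.Y ω| ≤ B)
    (hh : ∀ v, |h v| ≤ B) (hq : ∀ v, |q v| ≤ B) :
    ∀ᵐ x ∂(μ.map M.X), ∀ dz : 𝒳 × 𝒵 → ℤˣ, Measurable dz → ∀ dw : 𝒳 × 𝒲 → ℤˣ, Measurable dw →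
      M.delta μ h q dz dw x = M.meanZ μ h dz x - M.meanW μ q dw x := by
  filter_upwards [ae_condLaw_abs_le hY] with x hx dz hdz dw hdw
  refine integral_sub (f := outcomeTerm h dz x) (g := treatmentTerm q dw x) ?_ ?_
  · exact Integrable.of_bound ((measurable_outcomeTerm' hmh hdz).comp
      measurable_prodMk_left).aestronglyMeasurable B (Eventually.of_forall fun o => hh _)
  · exact Integrable.of_bound ((measurable_treatmentTerm' hmq hdw).comp
      measurable_prodMk_left).aestronglyMeasurable (B * B)
      (hx.mono fun o ho => abs_treatmentTerm_le hq dw x ho)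

theorem measurable_ite_mean (hmh : Measurable h) (hmq : Measurable q) {π : 𝒳 → Bool}
    (hπ : Measurable π) {dz : 𝒳 × 𝒵 → ℤˣ} (hdz : Measurable dz) {dw : 𝒳 × 𝒲 → ℤˣ}
    (hdw : Measurable dw) :
    Measurable fun x => if π x then M.meanZ μ h dz x else M.meanW μ q dw x :=
  Measurable.ite (hπ (measurableSet_singleton true)) (measurable_meanZ' hmh hdz)
    (measurable_meanW' hmq hdw)

theorem integral_add_add_add {f₁ g₁ f₂ g₂ : Ω → ℝ} (hf₁ : Integrable f₁ μ) (hg₁ : Integrable g₁ μ)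
    (hf₂ : Integrable f₂ μ) (hg₂ : Integrable g₂ μ) :
    ∫ ω, ((f₁ ω + g₁ ω) + (f₂ ω + g₂ ω)) ∂μ =
      (∫ ω, f₁ ω ∂μ + ∫ ω, g₁ ω ∂μ) + (∫ ω, f₂ ω ∂μ + ∫ ω, g₂ ω ∂μ) := by
  rw [← integral_add hf₁ hg₁, ← integral_add hf₂ hg₂]
  exact integral_add (hf₁.add hg₁) (hf₂.add hg₂)

/-- Identification of the value of a combined regime by the two bridges. -/
theorem value_combine (hstd : M.StandardAssumptions μ)
    (hcompZ : ProxyComplete μ M.U M.Z M.A M.X) (hcompW : ProxyComplete μ M.U M.W M.A M.X)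
    (hbridge : M.IsOutcomeBridge μ h) (qbridge : M.IsTreatmentBridge μ q)
    (hY : ∀ᵐ ω ∂μ, |M.Y ω| ≤ B) (hh : ∀ v, |h v| ≤ B) (hq : ∀ v, |q v| ≤ B)
    (hinv : ∀ a, Integrable (fun ω => (1 / M.propensityUX μ a ω) ^ 2) μ)
    {π : 𝒳 → Bool} (hπ : Measurable π) {dz : 𝒳 × 𝒵 → ℤˣ} (hdz : Measurable dz)
    {dw : 𝒳 × 𝒲 → ℤˣ} (hdw : Measurable dw) :
    M.value μ (combine π dz dw) =
      ∫ x, (if π x then M.meanZ μ h dz x else M.meanW μ q dw x) ∂(μ.map M.X) := by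
  have hmh := hbridge.1
  have hmq := qbridge.1
  have mX := M.measurable_X
  have mZ := M.measurable_Z
  have mW := M.measurable_W
  have mY := M.measurable_Y
  -- The indicators that the combined regime assigns `a` through `d_z` or through `d_w`. The first
  -- is a function of `(X, Z)` and the second of `(X, W)`, as the two bridge identities require.
  let sz : ℤˣ → 𝒳 × 𝒵 → ℝ := fun a v => if π v.1 = true ∧ dz v = a then 1 else 0
  let sw : ℤˣ → 𝒳 × 𝒲 → ℝ := fun a v => if π v.1 = false ∧ dw v = a then 1 else 0
  have hsz : ∀ a, Measurable (sz a) := fun a =>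
    Measurable.ite (((hπ.comp measurable_fst) (measurableSet_singleton true)).inter
      (hdz (measurableSet_singleton a))) measurable_const measurable_const
  have hsw : ∀ a, Measurable (sw a) := fun a =>
    Measurable.ite (((hπ.comp measurable_fst) (measurableSet_singleton false)).inter
      (hdw (measurableSet_singleton a))) measurable_const measurable_const
  have hsz1 : ∀ a v, |sz a v| ≤ 1 := fun a v => by simp only [sz]; split_ifs <;> simp
  have hsw1 : ∀ a v, |sw a v| ≤ 1 := fun a v => by simp only [sw]; split_ifs <;> simp
  have hYa : ∀ a, Integrable (fun ω => M.Ya a ω) μ := fun a =>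
    Integrable.of_bound (M.measurable_Ya a).aestronglyMeasurable B (abs_Ya_le hstd hY a)
  have hiz : ∀ a, Integrable (fun ω => sz a (M.X ω, M.Z ω) * M.Ya a ω) μ := fun a =>
    (hYa a).bdd_mul ((hsz a).comp (mX.prodMk mZ)).aestronglyMeasurable
      (Eventually.of_forall fun ω => hsz1 a _)
  have hiw : ∀ a, Integrable (fun ω => sw a (M.X ω, M.W ω) * M.Ya a ω) μ := fun a =>
    (hYa a).bdd_mul ((hsw a).comp (mX.prodMk mW)).aestronglyMeasurable
      (Eventually.of_forall fun ω => hsw1 a _)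
  have hizh : ∀ a, Integrable (fun ω => sz a (M.X ω, M.Z ω) * h (M.W ω, a, M.X ω)) μ := fun a =>
    (integrable_of_abs_le (by fun_prop) fun ω => hh _).bdd_mul
      ((hsz a).comp (mX.prodMk mZ)).aestronglyMeasurable (Eventually.of_forall fun ω => hsz1 a _)
  have hiwq : ∀ a, Integrable (fun ω => weightedTreat 𝒰 q a ((M.U ω, M.X ω), (M.Z ω, M.A ω)) *
      (sw a (M.X ω, M.W ω) * M.Ya a ω)) μ := fun a =>
    (hiw a).bdd_mul ((measurable_weightedTreat hmq a).comp
      (M.measurable_UX.prodMk M.measurable_ZA)).aestronglyMeasurable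
      (Eventually.of_forall fun ω => abs_weightedTreat_le hq a _)
  let F : 𝒳 × 𝒲 × 𝒵 × ℤˣ × ℝ → ℝ := fun p =>
    if π p.1 then outcomeTerm h dz p.1 p.2 else treatmentTerm q dw p.1 p.2
  have hF : Measurable F :=
    Measurable.ite ((hπ.comp measurable_fst) (measurableSet_singleton true))
      (measurable_outcomeTerm' hmh hdz) (measurable_treatmentTerm' hmq hdw)
  have hFi : Integrable (fun ω => F (M.X ω, M.W ω, M.Z ω, M.A ω, M.Y ω)) μ := by
    refine Integrable.of_bound (hF.comp M.measurable_X_obs).aestronglyMeasurable (max B (B * B)) ?_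
    filter_upwards [hY] with ω hω
    simp only [F]
    split_ifs
    · exact (hh _).trans (le_max_left _ _)
    · exact (abs_treatmentTerm_le hq dw _ hω).trans (le_max_right _ _)
  have hval : M.value μ (combine π dz dw) =
      ∫ ω, ((sz 1 (M.X ω, M.Z ω) * M.Ya 1 ω + sw 1 (M.X ω, M.W ω) * M.Ya 1 ω) +
        (sz (-1) (M.X ω, M.Z ω) * M.Ya (-1) ω + sw (-1) (M.X ω, M.W ω) * M.Ya (-1) ω)) ∂μ := by
    refine integral_congr_ae (Eventually.of_forall fun ω => ?_)
    cases hπω : π (M.X ω) <;> simp [combine, sz, sw, hπω]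
  -- Reassembly after both bridges: where `π = 0`, only the term with `d_w = a = A` survives, and
  -- there `Y(a)` is the observed `Y`.
  have hsum : ∫ ω, F (M.X ω, M.W ω, M.Z ω, M.A ω, M.Y ω) ∂μ =
      ∫ ω, ((sz 1 (M.X ω, M.Z ω) * h (M.W ω, 1, M.X ω) +
          weightedTreat 𝒰 q 1 ((M.U ω, M.X ω), (M.Z ω, M.A ω)) *
            (sw 1 (M.X ω, M.W ω) * M.Ya 1 ω)) +
        (sz (-1) (M.X ω, M.Z ω) * h (M.W ω, -1, M.X ω) +
          weightedTreat 𝒰 q (-1) ((M.U ω, M.X ω), (M.Z ω, M.A ω)) *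
            (sw (-1) (M.X ω, M.W ω) * M.Ya (-1) ω))) ∂μ := by
    refine integral_congr_ae ?_
    filter_upwards [Y_ae_eq_Ya hstd 1, Y_ae_eq_Ya hstd (-1)] with ω h1 h2
    have h11 : (1 : ℤˣ) ≠ -1 := by decide
    cases hπω : π (M.X ω)
    · rcases Int.units_eq_one_or (M.A ω) with hA | hA <;>
        rcases Int.units_eq_one_or (dw (M.X ω, M.W ω)) with hd | hd <;>
        simp [F, sz, sw, hπω, treatmentTerm, weightedTreat, treatInd, hA, hd, h11, h11.symm,
          ← h1, ← h2, mul_comm]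
    · rcases Int.units_eq_one_or (dz (M.X ω, M.Z ω)) with hd | hd <;>
        simp [F, sz, sw, hπω, outcomeTerm, hd, h11, h11.symm]
  rw [hval, integral_add_add_add (hiz 1) (hiw 1) (hiz (-1)) (hiw (-1))]
  simp only [integral_mul_Ya hstd hcompZ hbridge hY hh _ (hsz _) (hsz1 _)]
  simp only [← integral_weightedTreat_mul_Ya hstd hcompW qbridge hY hq hinv _ (hsw _) (hsw1 _)]
  rw [← integral_add_add_add (hizh 1) (hiwq 1) (hizh (-1)) (hiwq (-1))]
  refine hsum.symm.trans ((integral_condLaw hF hFi).trans ?_)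
  refine integral_congr_ae (Eventually.of_forall fun x => ?_)
  cases hπx : π x <;> simp [F, hπx] <;> rfl

end Value

end ProximalModel

/-! ### Convergence in probability of integrated errors. -/

section ConvergenceInProbability

variable {Ξ 𝒳 : Type*} [MeasurableSpace Ξ] [MeasurableSpace 𝒳] {P : Measure Ξ}
  [IsProbabilityMeasure P] {ν : Measure 𝒳} [IsProbabilityMeasure ν]

/-- Bounded convergence in probability: the mean is at most `ε` plus `C` times the probability of
exceeding `ε`. -/
theorem lintegral_tendsto_zero_of_tendsto_measure {f : ℕ → Ξ → ℝ} {C : ℝ}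
    (hf : ∀ n, Measurable (f n)) (hC : ∀ n ξ, |f n ξ| ≤ C)
    (hlim : ∀ ε : ℝ, 0 < ε → Tendsto (fun n => P {ξ | ε < |f n ξ|}) atTop (𝓝 0)) :
    Tendsto (fun n => ∫⁻ ξ, ENNReal.ofReal |f n ξ| ∂P) atTop (𝓝 0) := by
  have hbound : ∀ (ε : ℝ) (n : ℕ), ∫⁻ ξ, ENNReal.ofReal |f n ξ| ∂P ≤
      ENNReal.ofReal ε + ENNReal.ofReal C * P {ξ | ε < |f n ξ|} := by
    intro ε n
    have hS : MeasurableSet {ξ | ε < |f n ξ|} := measurableSet_lt measurable_const (hf n).abs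
    calc ∫⁻ ξ, ENNReal.ofReal |f n ξ| ∂P
        ≤ ∫⁻ ξ, (ENNReal.ofReal ε +
            {ξ | ε < |f n ξ|}.indicator (fun _ => ENNReal.ofReal C) ξ) ∂P := by
          refine lintegral_mono fun ξ => ?_
          by_cases h : ε < |f n ξ|
          · rw [Set.indicator_of_mem (by exact h)]
            exact (ENNReal.ofReal_le_ofReal (hC n ξ)).trans le_add_self
          · exact (ENNReal.ofReal_le_ofReal (not_lt.1 h)).trans le_self_add
      _ = ENNReal.ofReal ε + ENNReal.ofReal C * P {ξ | ε < |f n ξ|} := by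
          rw [lintegral_add_left measurable_const, lintegral_indicator_const hS]
          simp
  refine ENNReal.tendsto_nhds_zero.2 fun ε hε => ?_
  obtain ⟨η, hη, hηε⟩ : ∃ η : ℝ, 0 < η ∧ ENNReal.ofReal η < ε := by
    obtain ⟨η, hη0, hη⟩ := ENNReal.lt_iff_exists_nnreal_btwn.1 hε
    exact ⟨η, by simpa using hη0, by simpa using hη⟩
  have h1 : Tendsto (fun n => ENNReal.ofReal η + ENNReal.ofReal C * P {ξ | η < |f n ξ|}) atTop
      (𝓝 (ENNReal.ofReal η + ENNReal.ofReal C * 0)) :=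
    tendsto_const_nhds.add (ENNReal.Tendsto.const_mul (hlim η hη) (Or.inr ENNReal.ofReal_ne_top))
  rw [mul_zero, add_zero] at h1
  filter_upwards [h1.eventually_lt_const hηε] with n hn
  exact (hbound η n).trans hn.le

/-- If random functions of `x` are uniformly bounded and converge to zero in probability for almost
every `x`, then so do their integrals. -/
theorem tendsto_measure_integral_abs {f : ℕ → Ξ → 𝒳 → ℝ} {C : ℝ}
    (hf : ∀ n, Measurable fun p : Ξ × 𝒳 => f n p.1 p.2)
    (hC : ∀ᵐ x ∂ν, ∀ n ξ, |f n ξ x| ≤ C)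
    (hlim : ∀ᵐ x ∂ν, ∀ ε : ℝ, 0 < ε → Tendsto (fun n => P {ξ | ε < |f n ξ x|}) atTop (𝓝 0))
    {ε : ℝ} (hε : 0 < ε) :
    Tendsto (fun n => P {ξ | ε ≤ ∫ x, |f n ξ x| ∂ν}) atTop (𝓝 0) := by
  have hm : ∀ n, Measurable fun p : Ξ × 𝒳 => ENNReal.ofReal |f n p.1 p.2| := fun n =>
    (hf n).abs.ennreal_ofReal
  have hx : ∀ᵐ x ∂ν, Tendsto (fun n => ∫⁻ ξ, ENNReal.ofReal |f n ξ x| ∂P) atTop (𝓝 0) := by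
    filter_upwards [hC, hlim] with x h1 h2
    exact lintegral_tendsto_zero_of_tendsto_measure (fun n => (hf n).comp measurable_prodMk_right)
      h1 h2
  -- The mean error at each `x` tends to zero and is dominated by `C`, so its integral over `x`
  -- tends to zero.
  have hlim2 : Tendsto (fun n => ∫⁻ x, ∫⁻ ξ, ENNReal.ofReal |f n ξ x| ∂P ∂ν) atTop (𝓝 0) := by
    have := tendsto_lintegral_of_dominated_convergence (μ := ν)
      (F := fun n x => ∫⁻ ξ, ENNReal.ofReal |f n ξ x| ∂P) (f := fun _ => 0)
      (fun _ => ENNReal.ofReal C) (fun n => (hm n).lintegral_prod_left')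
      (fun n => by
        filter_upwards [hC] with x h1
        calc _ ≤ ∫⁻ _, ENNReal.ofReal C ∂P :=
              lintegral_mono fun ξ => ENNReal.ofReal_le_ofReal (h1 n ξ)
          _ = ENNReal.ofReal C := by simp)
      (by simp) hx
    simpa using this
  -- Tonelli exchanges the two integrals, after which Markov's inequality applies in the training
  -- data.
  have hmarkov : ∀ n, P {ξ | ε ≤ ∫ x, |f n ξ x| ∂ν} ≤
      (∫⁻ x, ∫⁻ ξ, ENNReal.ofReal |f n ξ x| ∂P ∂ν) / ENNReal.ofReal ε := by
    intro n
    rw [lintegral_lintegral_swap (f := fun x ξ => ENNReal.ofReal |f n ξ x|)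
      ((hm n).comp measurable_swap).aemeasurable]
    refine le_trans (measure_mono fun ξ hξ => ?_)
      (meas_ge_le_lintegral_div (hm n).lintegral_prod_right'.aemeasurable
        (ENNReal.ofReal_pos.2 hε).ne' ENNReal.ofReal_ne_top)
    refine (ENNReal.ofReal_le_ofReal hξ).trans ?_
    have hfm : Measurable fun x => f n ξ x := (hf n).comp measurable_prodMk_left
    rw [integral_eq_lintegral_of_nonneg_ae (Eventually.of_forall fun x => abs_nonneg _)
      hfm.abs.aestronglyMeasurable]
    exact ENNReal.ofReal_toReal_le
  refine tendsto_of_tendsto_of_tendsto_of_le_of_le tendsto_const_nhds ?_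
    (fun n => zero_le) hmarkov
  have := ENNReal.Tendsto.div_const hlim2 (b := ENNReal.ofReal ε)
    (Or.inr (ENNReal.ofReal_pos.2 hε).ne')
  simpa using this

theorem IsLittleOInProb.tendsto_measure {R : ℕ → Ξ → ℝ} {ζ : ℝ} (hζ : 0 < ζ)
    (hR : IsLittleOInProb P R fun n => (n : ℝ) ^ (-ζ)) {ε : ℝ} (hε : 0 < ε) :
    Tendsto (fun n => P {ξ | ε < |R n ξ|}) atTop (𝓝 0) := by
  refine tendsto_of_tendsto_of_tendsto_of_le_of_le' tendsto_const_nhds (hR ε hε)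
    (Eventually.of_forall fun n => zero_le) ?_
  filter_upwards [eventually_ge_atTop 1] with n hn
  refine measure_mono fun ξ hξ => ?_
  rw [Set.mem_ofPred_eq] at hξ ⊢
  refine lt_of_le_of_lt ?_ hξ
  have : (n : ℝ) ^ (-ζ) ≤ 1 :=
    Real.rpow_le_one_of_one_le_of_nonpos (by exact_mod_cast hn) (by linarith)
  exact mul_le_of_le_one_right hε.le this

end ConvergenceInProbability

/-- The second choice equals `max a' b'`. The first is within `ε` of `max a b`, since a wrong sign
of `δ` forces `a` and `b` to be within `ε` of each other. The rest is the Lipschitz property of the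
maximum. -/
theorem abs_ite_sub_ite_le {a b a' b' δ ε : ℝ} (hδ : |δ - (a - b)| ≤ ε) :
    |(if 0 ≤ δ then a else b) - (if b' ≤ a' then a' else b')| ≤ |a - a'| + |b - b'| + ε := by
  have h1 := abs_le.1 hδ
  have h2 := abs_le.1 (le_refl |a - a'|)
  have h3 := abs_le.1 (le_refl |b - b'|)
  rw [abs_le]
  split_ifs <;> constructor <;> linarith [h1.1, h1.2, h2.1, h2.2, h3.1, h3.2]

/-! ### Consistency of the value from uniform consistency of the contrast. -/

namespace ProximalModel

variable {Ω 𝒰 𝒳 𝒲 𝒵 Ξ : Type*} [MeasurableSpace Ω] [StandardBorelSpace Ω] [MeasurableSpace 𝒰]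
  [StandardBorelSpace 𝒰] [Nonempty 𝒰]
  [MeasurableSpace 𝒳] [MeasurableSpace 𝒲] [MeasurableSpace 𝒵]
  [StandardBorelSpace 𝒲] [StandardBorelSpace 𝒵] [Nonempty 𝒲] [Nonempty 𝒵] [MeasurableSpace Ξ]
  {M : ProximalModel Ω 𝒰 𝒳 𝒲 𝒵} {μ : Measure Ω} [IsProbabilityMeasure μ]
  {P : Measure Ξ} [IsProbabilityMeasure P]
  {h : 𝒲 × ℤˣ × 𝒳 → ℝ} {q : 𝒵 × ℤˣ × 𝒳 → ℝ} {B : ℝ}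

/-- Consistency of the value of the learned combined regime, for a uniformly consistent estimator
of the contrast. -/
theorem tendstoInMeasure_value_of_isUniformlyConsistent (hstd : M.StandardAssumptions μ)
    (hcompZ : ProxyComplete μ M.U M.Z M.A M.X) (hcompW : ProxyComplete μ M.U M.W M.A M.X)
    (hbridge : M.IsOutcomeBridge μ h) (qbridge : M.IsTreatmentBridge μ q)
    (hY : ∀ᵐ ω ∂μ, |M.Y ω| ≤ B) (hh : ∀ v, |h v| ≤ B) (hq : ∀ v, |q v| ≤ B)
    (hinv : ∀ a, Integrable (fun ω => (1 / M.propensityUX μ a ω) ^ 2) μ)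
    {dz : 𝒳 × 𝒵 → ℤˣ} (hdz : Measurable dz) {dw : 𝒳 × 𝒲 → ℤˣ} (hdw : Measurable dw)
    {dzHat : ℕ → Ξ → 𝒳 × 𝒵 → ℤˣ}
    (hdzHat : ∀ n, Measurable fun s : Ξ × (𝒳 × 𝒵) => dzHat n s.1 s.2)
    {dwHat : ℕ → Ξ → 𝒳 × 𝒲 → ℤˣ}
    (hdwHat : ∀ n, Measurable fun s : Ξ × (𝒳 × 𝒲) => dwHat n s.1 s.2)
    {ζ φ : ℝ} (hζ : 0 < ζ) (hφ : 0 < φ)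
    (hrateZ : ∀ᵐ x ∂(μ.map M.X), IsLittleOInProb P
      (fun n ξ => M.meanZ μ h (dzHat n ξ) x - M.meanZ μ h dz x) (fun n => (n : ℝ) ^ (-ζ)))
    (hrateW : ∀ᵐ x ∂(μ.map M.X), IsLittleOInProb P
      (fun n ξ => M.meanW μ q (dwHat n ξ) x - M.meanW μ q dw x) (fun n => (n : ℝ) ^ (-φ)))
    {deltaHat : ℕ → Ξ → 𝒳 → ℝ}
    (hdelta : M.IsUniformlyConsistent μ P h q dzHat dwHat deltaHat) :
    TendstoInMeasure P
      (fun n ξ => M.value μ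
        (combine (fun x => decide (0 ≤ deltaHat n ξ x)) (dzHat n ξ) (dwHat n ξ)))
      atTop (fun _ => M.value μ (combine (M.piBar μ h q dz dw) dz dw)) := by
  have hmh := hbridge.1
  have hmq := qbridge.1
  have := Measure.isProbabilityMeasure_map (μ := μ) M.measurable_X.aemeasurable
  set ν := μ.map M.X with hν
  obtain ⟨hdm, hdc⟩ := hdelta
  have mdz : ∀ n ξ, Measurable (dzHat n ξ) := fun n ξ => (hdzHat n).comp measurable_prodMk_left
  have mdw : ∀ n ξ, Measurable (dwHat n ξ) := fun n ξ => (hdwHat n).comp measurable_prodMk_left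
  have mπ : ∀ n ξ, Measurable fun x => decide (0 ≤ deltaHat n ξ x) := by
    intro n ξ
    refine measurable_to_bool ?_
    have : MeasurableSet {x | 0 ≤ deltaHat n ξ x} :=
      measurableSet_le measurable_const ((hdm n).comp measurable_prodMk_left)
    convert! this using 1
    ext x; simp
  have mπ' : Measurable (M.piBar μ h q dz dw) := by
    refine measurable_to_bool ?_
    have : MeasurableSet {x | M.meanW μ q dw x ≤ M.meanZ μ h dz x} :=
      measurableSet_le (measurable_meanW' hmq hdw) (measurable_meanZ' hmh hdz)
    convert! this using 1
    ext x; simp [piBar]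
  have hval := fun {π : 𝒳 → Bool} (hπ : Measurable π) {dz : 𝒳 × 𝒵 → ℤˣ} (hdz : Measurable dz)
    {dw : 𝒳 × 𝒲 → ℤˣ} (hdw : Measurable dw) => value_combine hstd hcompZ hcompW hbridge qbridge
      hY hh hq hinv hπ hdz hdw
  have hbW := abs_meanW_le (M := M) hY hq
  have hfZ : ∀ n, Measurable fun p : Ξ × 𝒳 => M.meanZ μ h (dzHat n p.1) p.2 - M.meanZ μ h dz p.2 :=
    fun n => (measurable_meanZ hmh (hdzHat n)).sub ((measurable_meanZ' hmh hdz).comp measurable_snd)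
  have hfW : ∀ n, Measurable fun p : Ξ × 𝒳 => M.meanW μ q (dwHat n p.1) p.2 - M.meanW μ q dw p.2 :=
    fun n => (measurable_meanW hmq (hdwHat n)).sub ((measurable_meanW' hmq hdw).comp measurable_snd)
  have hCZ : ∀ᵐ x ∂ν, ∀ n ξ, |M.meanZ μ h (dzHat n ξ) x - M.meanZ μ h dz x| ≤ B + B :=
    Eventually.of_forall fun x n ξ =>
      (abs_sub _ _).trans (add_le_add (abs_meanZ_le hh _ x) (abs_meanZ_le hh _ x))
  have hCW : ∀ᵐ x ∂ν, ∀ n ξ, |M.meanW μ q (dwHat n ξ) x - M.meanW μ q dw x| ≤ B * B + B * B := by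
    filter_upwards [hbW] with x hx n ξ
    exact (abs_sub _ _).trans (add_le_add (hx _) (hx _))
  have hgi : ∀ {π : 𝒳 → Bool}, Measurable π → ∀ {dz : 𝒳 × 𝒵 → ℤˣ}, Measurable dz →
      ∀ {dw : 𝒳 × 𝒲 → ℤˣ}, Measurable dw →
      Integrable (fun x => if π x then M.meanZ μ h dz x else M.meanW μ q dw x) ν := by
    intro π hπ dz hdz dw hdw
    refine Integrable.of_bound (measurable_ite_mean hmh hmq hπ hdz hdw).aestronglyMeasurable
      (max B (B * B)) ?_
    filter_upwards [hbW] with x hx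
    split_ifs
    · exact (abs_meanZ_le hh _ x).trans (le_max_left _ _)
    · exact (hx _).trans (le_max_right _ _)
  refine tendstoInMeasure_iff_dist.2 fun ε hε => ?_
  -- The contrast is allowed `ε/3` and each integrated mean error `ε/6`. The total is below `2ε/3`,
  -- which contradicts a deviation of at least `ε`.
  have hε3 : 0 < ε / 3 := by positivity
  have hεz := tendsto_measure_integral_abs hfZ hCZ
    (hrateZ.mono fun x hx η hη => hx.tendsto_measure hζ hη) (P := P) (half_pos hε3)
  have hεw := tendsto_measure_integral_abs hfW hCW
    (hrateW.mono fun x hx η hη => hx.tendsto_measure hφ hη) (P := P) (half_pos hε3)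
  have hsum := ((hdc (ε / 3) hε3).add hεz).add hεw
  simp only [add_zero] at hsum
  refine tendsto_of_tendsto_of_tendsto_of_le_of_le tendsto_const_nhds hsum
    (fun n => zero_le) fun n => ?_
  refine le_trans (measure_mono fun ξ hξ => ?_)
    ((measure_union_le _ _).trans (add_le_add_left (measure_union_le _ _) _))
  by_contra hcon
  simp only [Set.mem_union, Set.mem_ofPred_eq, not_or, not_not, not_le] at hcon
  obtain ⟨⟨h1, h2⟩, h3⟩ := hcon
  have hξ' : ε ≤ dist (M.value μ
        (combine (fun x => decide (0 ≤ deltaHat n ξ x)) (dzHat n ξ) (dwHat n ξ)))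
      (M.value μ (combine (M.piBar μ h q dz dw) dz dw)) := hξ
  rw [hval (mπ n ξ) (mdz n ξ) (mdw n ξ), hval mπ' hdz hdw, Real.dist_eq,
    ← integral_sub (hgi (mπ n ξ) (mdz n ξ) (mdw n ξ)) (hgi mπ' hdz hdw)] at hξ'
  have iZ : Integrable (fun x => |M.meanZ μ h (dzHat n ξ) x - M.meanZ μ h dz x|) ν :=
    (Integrable.of_bound ((hfZ n).comp measurable_prodMk_left).aestronglyMeasurable (B + B)
      (hCZ.mono fun x hx => hx n ξ)).abs
  have iW : Integrable (fun x => |M.meanW μ q (dwHat n ξ) x - M.meanW μ q dw x|) ν :=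
    (Integrable.of_bound ((hfW n).comp measurable_prodMk_left).aestronglyMeasurable
      (B * B + B * B) (hCW.mono fun x hx => hx n ξ)).abs
  have hle : |∫ x, ((if decide (0 ≤ deltaHat n ξ x) = true then M.meanZ μ h (dzHat n ξ) x
        else M.meanW μ q (dwHat n ξ) x) -
      if M.piBar μ h q dz dw x = true then M.meanZ μ h dz x else M.meanW μ q dw x) ∂ν| ≤
      ∫ x, (|M.meanZ μ h (dzHat n ξ) x - M.meanZ μ h dz x| +
        |M.meanW μ q (dwHat n ξ) x - M.meanW μ q dw x| + ε / 3) ∂ν := by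
    refine (abs_integral_le_integral_abs).trans (integral_mono_ae
      ((hgi (mπ n ξ) (mdz n ξ) (mdw n ξ)).sub (hgi mπ' hdz hdw)).abs
      ((iZ.add iW).add (integrable_const _)) ?_)
    filter_upwards [h1, delta_eq_sub (M := M) hmh hmq hY hh hq] with x hx hx'
    rw [hx' _ (mdz n ξ) _ (mdw n ξ)] at hx
    simpa [piBar] using abs_ite_sub_ite_le (a' := M.meanZ μ h dz x) (b' := M.meanW μ q dw x) hx
  have hint := integral_add (iZ.add iW) (integrable_const (ε / 3))
  simp only [Pi.add_apply, integral_add iZ iW, integral_const, probReal_univ, one_smul] at hint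
  linarith

end ProximalModel

/-! ### The Nadaraya-Watson estimator. -/

theorem SupIsLittleOInProb.tendsto_measure {Ξ ι : Type*} [MeasurableSpace Ξ] {P : Measure Ξ}
    {R : ℕ → Ξ → ι → ℝ} {ζ : ℝ} (hζ : 0 < ζ)
    (hR : SupIsLittleOInProb P R fun n => (n : ℝ) ^ (-ζ)) {ε : ℝ} (hε : 0 < ε) :
    Tendsto (fun n => P {ξ | ∃ i, ε < |R n ξ i|}) atTop (𝓝 0) := by
  refine tendsto_of_tendsto_of_tendsto_of_le_of_le' tendsto_const_nhds (hR ε hε)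
    (Eventually.of_forall fun n => zero_le) ?_
  filter_upwards [eventually_ge_atTop 1] with n hn
  refine measure_mono fun ξ hξ => ?_
  rw [Set.mem_ofPred_eq] at hξ ⊢
  obtain ⟨i, hi⟩ := hξ
  refine ⟨i, lt_of_le_of_lt ?_ hi⟩
  have : (n : ℝ) ^ (-ζ) ≤ 1 :=
    Real.rpow_le_one_of_one_le_of_nonpos (by exact_mod_cast hn) (by linarith)
  exact mul_le_of_le_one_right hε.le this

/-- If all weights vanish, the quotient is `0 / 0 = 0` and the bound still holds, so no positivity
of the denominator is needed. -/
theorem abs_weighted_average_le {ι : Type*} (s : Finset ι) {c k : ι → ℝ} {C : ℝ} (hC : 0 ≤ C)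
    (hk : ∀ i, 0 ≤ k i) (hc : ∀ i, |c i| ≤ C) :
    |(∑ i ∈ s, c i * k i) / ∑ i ∈ s, k i| ≤ C := by
  have hk0 : 0 ≤ ∑ i ∈ s, k i := Finset.sum_nonneg fun i _ => hk i
  rw [abs_div, abs_of_nonneg hk0]
  refine div_le_of_le_mul₀ hk0 hC ((Finset.abs_sum_le_sum_abs _ _).trans ?_)
  rw [Finset.mul_sum]
  refine Finset.sum_le_sum fun i _ => ?_
  rw [abs_mul, abs_of_nonneg (hk i)]
  exact mul_le_mul_of_nonneg_right (hc i) (hk i)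

open ProximalModel

section NadarayaWatson

variable {p : ℕ} {𝒲 𝒵 : Type*} {K : ℝ → ℝ} {b : ℝ} {n : ℕ}
  {h h' : 𝒲 × ℤˣ × EuclideanSpace ℝ (Fin p) → ℝ} {q q' : 𝒵 × ℤˣ × EuclideanSpace ℝ (Fin p) → ℝ}
  {S : ℕ → EuclideanSpace ℝ (Fin p) × 𝒲 × 𝒵 × ℤˣ × ℝ} {x : EuclideanSpace ℝ (Fin p)}

theorem nadarayaWatson_eq (dz : EuclideanSpace ℝ (Fin p) × 𝒵 → ℤˣ)
    (dw : EuclideanSpace ℝ (Fin p) × 𝒲 → ℤˣ) :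
    nadarayaWatson K b n h q dz dw S x =
      (∑ i ∈ Finset.range n, (outcomeTerm h dz x (S i).2 - treatmentTerm q dw x (S i).2) *
        K (‖x - (S i).1‖ / b)) / ∑ i ∈ Finset.range n, K (‖x - (S i).1‖ / b) :=
  rfl

/-- The Nadaraya-Watson estimator is a function of `dz` plus a function of `dw`. -/
theorem nadarayaWatson_add (dz dz₀ : EuclideanSpace ℝ (Fin p) × 𝒵 → ℤˣ)
    (dw dw₀ : EuclideanSpace ℝ (Fin p) × 𝒲 → ℤˣ) :
    nadarayaWatson K b n h q dz dw S x = nadarayaWatson K b n h q dz dw₀ S x +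
      nadarayaWatson K b n h q dz₀ dw S x - nadarayaWatson K b n h q dz₀ dw₀ S x := by
  simp only [nadarayaWatson_eq, sub_mul, Finset.sum_sub_distrib, sub_div]
  ring

/-- Both estimators carry the same weights, so their difference is a weighted average of differences
of summands. The bound does not depend on the kernel, the bandwidth, `n`, `x` or the regimes. -/
theorem abs_nadarayaWatson_sub_le (hK : ∀ t, 0 ≤ K t) {η B : ℝ} (hη : 0 ≤ η) (hB : 0 ≤ B)
    (hh : ∀ v, |h' v - h v| ≤ η) (hq : ∀ v, |q' v - q v| ≤ η)
    (hS : ∀ i, |(S i).2.2.2.2| ≤ B) (dz : EuclideanSpace ℝ (Fin p) × 𝒵 → ℤˣ)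
    (dw : EuclideanSpace ℝ (Fin p) × 𝒲 → ℤˣ) :
    |nadarayaWatson K b n h' q' dz dw S x - nadarayaWatson K b n h q dz dw S x| ≤
      η + B * η := by
  rw [nadarayaWatson_eq, nadarayaWatson_eq, ← sub_div, ← Finset.sum_sub_distrib]
  simp only [← sub_mul]
  refine abs_weighted_average_le _ (by positivity) (fun i => hK _) fun i => ?_
  have h1 : |outcomeTerm h' dz x (S i).2 - outcomeTerm h dz x (S i).2| ≤ η := hh _
  have h2 : |treatmentTerm q' dw x (S i).2 - treatmentTerm q dw x (S i).2| ≤ B * η := by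
    unfold treatmentTerm
    split_ifs
    · rw [mul_one, mul_one, ← mul_sub, abs_mul]
      exact mul_le_mul (hS i) (hq _) (abs_nonneg _) hB
    · simpa using mul_nonneg hB hη
  rw [abs_le] at h1 h2 ⊢
  constructor <;> linarith [h1.1, h1.2, h2.1, h2.2]

theorem measurable_nadarayaWatson [MeasurableSpace 𝒲] [MeasurableSpace 𝒵] {Ξ : Type*}
    [MeasurableSpace Ξ] (hK : Measurable K)
    {h : Ξ → 𝒲 × ℤˣ × EuclideanSpace ℝ (Fin p) → ℝ}
    (hh : Measurable fun s : Ξ × (𝒲 × ℤˣ × EuclideanSpace ℝ (Fin p)) => h s.1 s.2)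
    {q : Ξ → 𝒵 × ℤˣ × EuclideanSpace ℝ (Fin p) → ℝ}
    (hq : Measurable fun s : Ξ × (𝒵 × ℤˣ × EuclideanSpace ℝ (Fin p)) => q s.1 s.2)
    {dz : Ξ → EuclideanSpace ℝ (Fin p) × 𝒵 → ℤˣ}
    (hdz : Measurable fun s : Ξ × (EuclideanSpace ℝ (Fin p) × 𝒵) => dz s.1 s.2)
    {dw : Ξ → EuclideanSpace ℝ (Fin p) × 𝒲 → ℤˣ}
    (hdw : Measurable fun s : Ξ × (EuclideanSpace ℝ (Fin p) × 𝒲) => dw s.1 s.2)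
    {S : ℕ → Ξ → EuclideanSpace ℝ (Fin p) × 𝒲 × 𝒵 × ℤˣ × ℝ} (hS : ∀ i, Measurable (S i)) :
    Measurable fun s : Ξ × EuclideanSpace ℝ (Fin p) =>
      nadarayaWatson K b n (h s.1) (q s.1) (dz s.1) (dw s.1) (fun i => S i s.1) s.2 := by
  simp only [nadarayaWatson_eq]
  have hKm : ∀ i, Measurable fun s : Ξ × EuclideanSpace ℝ (Fin p) =>
      K (‖s.2 - (S i s.1).1‖ / b) := fun i => by
    have := hS i
    fun_prop
  refine Measurable.div (Finset.measurable_sum _ fun i _ => ?_)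
    (Finset.measurable_sum _ fun i _ => hKm i)
  refine (Measurable.sub ?_ ?_).mul (hKm i)
  · unfold outcomeTerm
    have hSi := hS i
    have hd : Measurable fun s : Ξ × EuclideanSpace ℝ (Fin p) =>
        dz s.1 (s.2, (S i s.1).2.2.1) :=
      hdz.comp (measurable_fst.prodMk (measurable_snd.prodMk (by fun_prop)))
    exact hh.comp (measurable_fst.prodMk
      (Measurable.prodMk (by fun_prop) (hd.prodMk measurable_snd)))
  · unfold treatmentTerm
    have hSi := hS i
    have hd : Measurable fun s : Ξ × EuclideanSpace ℝ (Fin p) =>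
        dw s.1 (s.2, (S i s.1).2.1) :=
      hdw.comp (measurable_fst.prodMk (measurable_snd.prodMk (by fun_prop)))
    refine Measurable.mul (Measurable.mul (by fun_prop) ?_)
      (Measurable.ite (measurableSet_eq_fun hd (by fun_prop)) measurable_const measurable_const)
    exact hq.comp (measurable_fst.prodMk
      (Measurable.prodMk (by fun_prop) (Measurable.prodMk (by fun_prop) measurable_snd)))

end NadarayaWatson

/-! ### Union bound and uniform consistency of the Nadaraya-Watson estimator. -/

namespace ProximalModel

/-- A union bound over a finite class of events of probability at most `1 / n`. -/
theorem measure_biUnion_le_ncard_div {Ξ ι : Type*} [MeasurableSpace Ξ] {P : Measure Ξ}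
    {I : Set ι} (hI : I.Finite) {E : ι → Set Ξ} {n : ℕ}
    (hE : ∀ i ∈ I, P (E i) ≤ ENNReal.ofReal (1 / (n : ℝ))) :
    P (⋃ i ∈ I, E i) ≤ ENNReal.ofReal ((I.ncard : ℝ) / n) := by
  have h1 : (⋃ i ∈ I, E i) = ⋃ i ∈ hI.toFinset, E i := by simp
  rw [h1]
  refine (measure_biUnion_finset_le _ _).trans ?_
  refine (Finset.sum_le_card_nsmul _ _ (ENNReal.ofReal (1 / (n : ℝ))) fun i hi =>
    hE i (by simpa using hi)).trans (le_of_eq ?_)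
  rw [Set.ncard_eq_toFinset_card I hI, nsmul_eq_mul, div_eq_mul_one_div (hI.toFinset.card : ℝ),
    ENNReal.ofReal_mul (Nat.cast_nonneg _), ENNReal.ofReal_natCast]

/-- A union bound over two classes of events of sizes `o(n)`, each of probability at most `1 / n`. -/
theorem tendsto_measure_biUnion_union_zero {Ξ ι κ : Type*} [MeasurableSpace Ξ] {P : Measure Ξ}
    {I : ℕ → Set ι} {J : ℕ → Set κ} (hI : ∀ n, (I n).Finite) (hJ : ∀ n, (J n).Finite)
    (cI : (fun n => ((I n).ncard : ℝ)) =o[atTop] (fun n => (n : ℝ)))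
    (cJ : (fun n => ((J n).ncard : ℝ)) =o[atTop] (fun n => (n : ℝ)))
    {E : ℕ → ι → Set Ξ} {F : ℕ → κ → Set Ξ}
    (hE : ∀ n, 1 ≤ n → ∀ i ∈ I n, P (E n i) ≤ ENNReal.ofReal (1 / (n : ℝ)))
    (hF : ∀ n, 1 ≤ n → ∀ j ∈ J n, P (F n j) ≤ ENNReal.ofReal (1 / (n : ℝ))) :
    Tendsto (fun n => P ((⋃ i ∈ I n, E n i) ∪ ⋃ j ∈ J n, F n j)) atTop (𝓝 0) := by
  have hlim : ∀ {a : ℕ → ℝ}, a =o[atTop] (fun n : ℕ => (n : ℝ)) →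
      Tendsto (fun n => ENNReal.ofReal (a n / n)) atTop (𝓝 0) := by
    intro a ha
    simpa using ENNReal.tendsto_ofReal ha.tendsto_div_nhds_zero
  have hsum := (hlim cI).add (hlim cJ)
  rw [add_zero] at hsum
  refine tendsto_of_tendsto_of_tendsto_of_le_of_le' tendsto_const_nhds hsum
    (Eventually.of_forall fun n => zero_le) ?_
  filter_upwards [eventually_ge_atTop 1] with n hn
  exact (measure_union_le _ _).trans (add_le_add (measure_biUnion_le_ncard_div (hI n) (hE n hn))
    (measure_biUnion_le_ncard_div (hJ n) (hF n hn)))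

variable {p : ℕ} {Ω 𝒰 𝒲 𝒵 Ξ : Type*} [MeasurableSpace Ω] [StandardBorelSpace Ω]
  [MeasurableSpace 𝒰] [StandardBorelSpace 𝒰] [Nonempty 𝒰]
  [MeasurableSpace 𝒲] [MeasurableSpace 𝒵]
  [StandardBorelSpace 𝒲] [StandardBorelSpace 𝒵] [Nonempty 𝒲] [Nonempty 𝒵] [MeasurableSpace Ξ]
  {M : ProximalModel Ω 𝒰 (EuclideanSpace ℝ (Fin p)) 𝒲 𝒵} {μ : Measure Ω} [IsProbabilityMeasure μ]
  {P : Measure Ξ} [IsProbabilityMeasure P]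
  {h : 𝒲 × ℤˣ × EuclideanSpace ℝ (Fin p) → ℝ} {q : 𝒵 × ℤˣ × EuclideanSpace ℝ (Fin p) → ℝ} {B : ℝ}
  {dzHat : ℕ → Ξ → EuclideanSpace ℝ (Fin p) × 𝒵 → ℤˣ}
  {dwHat : ℕ → Ξ → EuclideanSpace ℝ (Fin p) × 𝒲 → ℤˣ}
  {deltaHat : ℕ → Ξ → EuclideanSpace ℝ (Fin p) → ℝ}
  {S : ℕ → Ξ → EuclideanSpace ℝ (Fin p) × 𝒲 × 𝒵 × ℤˣ × ℝ}
  {hHat : ℕ → Ξ → 𝒲 × ℤˣ × EuclideanSpace ℝ (Fin p) → ℝ}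
  {qHat : ℕ → Ξ → 𝒵 × ℤˣ × EuclideanSpace ℝ (Fin p) → ℝ}
  {K : ℝ → ℝ} {b : ℕ → ℝ}
  {DZ : ℕ → Set (EuclideanSpace ℝ (Fin p) × 𝒵 → ℤˣ)}
  {DW : ℕ → Set (EuclideanSpace ℝ (Fin p) × 𝒲 → ℤˣ)}
  {α β γ C : ℝ}

/-- The Nadaraya-Watson estimator is uniformly consistent for the contrast. The union bound is over
`|DZ n| + |DW n|` events only, by `nadarayaWatson_add`. -/
theorem IsNadarayaWatson.isUniformlyConsistent (hmh : Measurable h) (hmq : Measurable q)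
    (hY : ∀ᵐ ω ∂μ, |M.Y ω| ≤ B) (hh : ∀ v, |h v| ≤ B) (hq : ∀ v, |q v| ≤ B)
    (hdzHat : ∀ n, Measurable fun s : Ξ × (EuclideanSpace ℝ (Fin p) × 𝒵) => dzHat n s.1 s.2)
    (hdwHat : ∀ n, Measurable fun s : Ξ × (EuclideanSpace ℝ (Fin p) × 𝒲) => dwHat n s.1 s.2)
    (H : M.IsNadarayaWatson μ P h q dzHat dwHat deltaHat S hHat qHat K b DZ DW α β γ C) :
    M.IsUniformlyConsistent μ P h q dzHat dwHat deltaHat := by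
  refine ⟨fun n => ?_, fun ε hε => ?_⟩
  · simp only [H.deltaHat_eq]
    exact measurable_nadarayaWatson H.measurable_K (H.measurable_hHat n) (H.measurable_qHat n)
      (hdzHat n) (hdwHat n) H.measurable_S
  obtain ⟨ξ₀⟩ := P.nonempty_of_neZero
  obtain ⟨ω₀⟩ := μ.nonempty_of_neZero
  have hB : 0 ≤ B := (abs_nonneg _).trans (hh (M.W ω₀, 1, M.X ω₀))
  let bad : ℕ → (EuclideanSpace ℝ (Fin p) × 𝒵 → ℤˣ) → (EuclideanSpace ℝ (Fin p) × 𝒲 → ℤˣ) →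
      Set Ξ := fun n dz dw => {ξ | ¬ ∀ᵐ x ∂(μ.map M.X),
    |M.delta μ h q dz dw x - nadarayaWatson K (b n) n h q dz dw (fun i => S i ξ) x|
        ≤ C * (n : ℝ) ^ (-γ)}
  -- Non-random reference regimes in the classes: the estimates at one fixed realization `ξ₀`. The
  -- union bound covers only the pairs `(dz, z-side varying)` against `w₀` and the pairs with `z₀`
  -- against a varying `dw`.
  let z₀ : ∀ n : ℕ, EuclideanSpace ℝ (Fin p) × 𝒵 → ℤˣ := fun n => dzHat n ξ₀
  let w₀ : ∀ n : ℕ, EuclideanSpace ℝ (Fin p) × 𝒲 → ℤˣ := fun n => dwHat n ξ₀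
  have hz₀ : ∀ n, z₀ n ∈ DZ n := fun n => H.dzHat_mem n ξ₀
  have hw₀ : ∀ n, w₀ n ∈ DW n := fun n => H.dwHat_mem n ξ₀
  have hunion := tendsto_measure_biUnion_union_zero (P := P) H.finite_DZ H.finite_DW H.card_DZ
    H.card_DW (E := fun n dz => bad n dz (w₀ n)) (F := fun n dw => bad n (z₀ n) dw)
    (fun n hn dz hdz => H.oracle n hn dz hdz _ (hw₀ n))
    (fun n hn dw hdw => H.oracle n hn _ (hz₀ n) dw hdw)
  -- Chosen so that the plug-in error `η + B * η` equals `ε / 2`.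
  have hη : 0 < ε / (2 * (1 + B)) := by positivity
  have hlim := (hunion.add (H.rate_hHat.tendsto_measure H.α_pos hη)).add
    (H.rate_qHat.tendsto_measure H.β_pos hη)
  simp only [add_zero] at hlim
  have hYS : ∀ᵐ ξ ∂P, ∀ i, |(S i ξ).2.2.2.2| ≤ B := by
    refine ae_all_iff.2 fun i => ?_
    exact (H.identDistrib i).symm.ae_snd (p := fun s => |s.2.2.2.2| ≤ B)
      (measurableSet_le (by fun_prop) measurable_const) hY
  -- The factor 3 counts the oracle errors at the pairs `(dzHat, w₀)`, `(z₀, dwHat)` and `(z₀, w₀)`.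
  -- The last pair is already among the events of the first class.
  have hrate : ∀ᶠ n : ℕ in atTop, 3 * (C * (n : ℝ) ^ (-γ)) ≤ ε / 2 := by
    have h1 : Tendsto (fun n : ℕ => 3 * (C * (n : ℝ) ^ (-γ))) atTop (𝓝 (3 * (C * 0))) :=
      (((tendsto_rpow_neg_atTop H.γ_pos).comp tendsto_natCast_atTop_atTop).const_mul C).const_mul 3
    simp only [mul_zero] at h1
    exact (h1.eventually_lt_const (half_pos hε)).mono fun n hn => hn.le
  refine tendsto_of_tendsto_of_tendsto_of_le_of_le' tendsto_const_nhds hlim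
    (Eventually.of_forall fun n => zero_le) ?_
  filter_upwards [hrate] with n hn
  refine le_trans (measure_mono_ae ?_)
    ((measure_union_le _ _).trans (add_le_add_left (measure_union_le _ _) _))
  filter_upwards [hYS] with ξ hξS hξ
  change ξ ∈ (_ ∪ _ ∪ _ : Set Ξ)
  by_contra hcon
  refine hξ ?_
  simp only [Set.mem_union, Set.mem_ofPred_eq, not_or, not_exists, not_lt, Set.mem_iUnion,
    exists_prop, not_and] at hcon
  obtain ⟨⟨⟨h1, h2⟩, h3⟩, h4⟩ := hcon
  have hbad : ∀ dz dw, ¬ ξ ∈ bad n dz dw → ∀ᵐ x ∂(μ.map M.X),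
      |M.delta μ h q dz dw x - nadarayaWatson K (b n) n h q dz dw (fun i => S i ξ) x|
        ≤ C * (n : ℝ) ^ (-γ) := fun dz dw hx => not_not.1 hx
  filter_upwards [hbad _ _ (h1 _ (H.dzHat_mem n ξ)), hbad _ _ (h2 _ (H.dwHat_mem n ξ)),
    hbad _ _ (h1 _ (hz₀ n)), delta_eq_sub (M := M) hmh hmq hY hh hq] with x x1 x2 x3 x4
  have mz := H.measurable_DZ n
  have mw := H.measurable_DW n
  have hplug := abs_nadarayaWatson_sub_le (K := K) (b := b n) (n := n) (x := x)
    (S := fun i => S i ξ) H.K_nonneg hη.le hB h3 h4 hξS (dzHat n ξ) (dwHat n ξ)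
  -- By `delta_eq_sub` the contrast obeys the same additive identity at almost every `x`. The oracle
  -- error at the estimated pair is therefore a signed sum of the three controlled errors.
  have hadd := nadarayaWatson_add (K := K) (b := b n) (n := n) (h := h) (q := q) (x := x)
    (S := fun i => S i ξ) (dzHat n ξ) (z₀ n) (dwHat n ξ) (w₀ n)
  have heq : ε / (2 * (1 + B)) + B * (ε / (2 * (1 + B))) = ε / 2 := by
    field_simp
  rw [heq, ← H.deltaHat_eq] at hplug
  rw [x4 _ (mz _ (H.dzHat_mem n ξ)) _ (mw _ (hw₀ n))] at x1
  rw [x4 _ (mz _ (hz₀ n)) _ (mw _ (H.dwHat_mem n ξ))] at x2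
  rw [x4 _ (mz _ (hz₀ n)) _ (mw _ (hw₀ n))] at x3
  rw [x4 _ (mz _ (H.dzHat_mem n ξ)) _ (mw _ (H.dwHat_mem n ξ))]
  rw [hadd] at hplug
  rw [abs_le] at x1 x2 x3 hplug ⊢
  constructor <;> linarith [x1.1, x1.2, x2.1, x2.2, x3.1, x3.2, hplug.1, hplug.2]

end ProximalModel

theorem proposition3 {p : ℕ} {Ω 𝒰 𝒲 𝒵 Ξ : Type*}
    [MeasurableSpace Ω] [StandardBorelSpace Ω]
    [MeasurableSpace 𝒰] [StandardBorelSpace 𝒰] [Nonempty 𝒰]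
    [MeasurableSpace 𝒲] [StandardBorelSpace 𝒲] [Nonempty 𝒲]
    [MeasurableSpace 𝒵] [StandardBorelSpace 𝒵] [Nonempty 𝒵]
    [MeasurableSpace Ξ]
    -- the population
    (μ : Measure Ω) [IsProbabilityMeasure μ]
    (M : ProximalModel Ω 𝒰 (EuclideanSpace ℝ (Fin p)) 𝒲 𝒵)
    -- the training data live on their own probability space
    (P : Measure Ξ) [IsProbabilityMeasure P]
    -- causal assumptions, completeness and the two bridges
    (hstd : M.StandardAssumptions μ)
    (hcompZ : ProxyComplete μ M.U M.Z M.A M.X)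
    (hcompW : ProxyComplete μ M.U M.W M.A M.X)
    (h : 𝒲 × ℤˣ × EuclideanSpace ℝ (Fin p) → ℝ) (hbridge : M.IsOutcomeBridge μ h)
    (q : 𝒵 × ℤˣ × EuclideanSpace ℝ (Fin p) → ℝ) (qbridge : M.IsTreatmentBridge μ q)
    -- boundedness, and square-integrability of the inverse latent propensity
    (B : ℝ) (hY : ∀ᵐ ω ∂μ, |M.Y ω| ≤ B) (hh : ∀ v, |h v| ≤ B) (hq : ∀ v, |q v| ≤ B)
    (hinv : ∀ a, Integrable (fun ω => (1 / M.propensityUX μ a ω) ^ 2) μ)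
    -- in-class optimal regimes
    (dz : EuclideanSpace ℝ (Fin p) × 𝒵 → ℤˣ) (hdz : M.IsOptimalZ μ dz)
    (dw : EuclideanSpace ℝ (Fin p) × 𝒲 → ℤˣ) (hdw : M.IsOptimalW μ dw)
    -- preliminary estimated regimes, for each sample size, and their rates
    (dzHat : ℕ → Ξ → EuclideanSpace ℝ (Fin p) × 𝒵 → ℤˣ)
    (hdzHat : ∀ n, Measurable fun s : Ξ × (EuclideanSpace ℝ (Fin p) × 𝒵) => dzHat n s.1 s.2)
    (dwHat : ℕ → Ξ → EuclideanSpace ℝ (Fin p) × 𝒲 → ℤˣ)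
    (hdwHat : ∀ n, Measurable fun s : Ξ × (EuclideanSpace ℝ (Fin p) × 𝒲) => dwHat n s.1 s.2)
    (ζ φ : ℝ) (hζ : 0 < ζ) (hφ : 0 < φ)
    (hrateZ : ∀ᵐ x ∂(μ.map M.X), IsLittleOInProb P
      (fun n ξ => M.meanZ μ h (dzHat n ξ) x - M.meanZ μ h dz x) (fun n => (n : ℝ) ^ (-ζ)))
    (hrateW : ∀ᵐ x ∂(μ.map M.X), IsLittleOInProb P
      (fun n ξ => M.meanW μ q (dwHat n ξ) x - M.meanW μ q dw x) (fun n => (n : ℝ) ^ (-φ)))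
    -- the estimator of the contrast: Nadaraya-Watson, or any uniformly consistent one
    (deltaHat : ℕ → Ξ → EuclideanSpace ℝ (Fin p) → ℝ)
    (hdelta :
      (∃ (S : ℕ → Ξ → EuclideanSpace ℝ (Fin p) × 𝒲 × 𝒵 × ℤˣ × ℝ)
        (hHat : ℕ → Ξ → 𝒲 × ℤˣ × EuclideanSpace ℝ (Fin p) → ℝ)
        (qHat : ℕ → Ξ → 𝒵 × ℤˣ × EuclideanSpace ℝ (Fin p) → ℝ)
        (K : ℝ → ℝ) (b : ℕ → ℝ)
        (DZ : ℕ → Set (EuclideanSpace ℝ (Fin p) × 𝒵 → ℤˣ))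
        (DW : ℕ → Set (EuclideanSpace ℝ (Fin p) × 𝒲 → ℤˣ))
        (α β γ C : ℝ),
        M.IsNadarayaWatson μ P h q dzHat dwHat deltaHat S hHat qHat K b DZ DW α β γ C) ∨
      M.IsUniformlyConsistent μ P h q dzHat dwHat deltaHat) :
    TendstoInMeasure P
      (fun n ξ => M.value μ
        (ProximalModel.combine (fun x => decide (0 ≤ deltaHat n ξ x)) (dzHat n ξ) (dwHat n ξ)))
      atTop
      (fun _ => M.value μ (ProximalModel.combine (M.piBar μ h q dz dw) dz dw)) := by
  have hcons : M.IsUniformlyConsistent μ P h q dzHat dwHat deltaHat := by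
    rcases hdelta with ⟨S, hHat, qHat, K, b, DZ, DW, α, β, γ, C, H⟩ | H
    · exact H.isUniformlyConsistent hbridge.1 qbridge.1 hY hh hq hdzHat hdwHat
    · exact H
  exact ProximalModel.tendstoInMeasure_value_of_isUniformlyConsistent hstd hcompZ hcompW hbridge
    qbridge hY hh hq hinv hdz.1 hdw.1 hdzHat hdwHat hζ hφ hrateZ hrateW hcons
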